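/- Let $S$ be a finite unrooted tree with $n\ge 1$ nodes. A *search tree on $S$* is a rooted tree $T$ with $V(T)=V(S)$ such that, for its root $r$, the subtrees of $T$ rooted at the children of $r$ are, recursively, search trees on the connected components of $S\setminus r$ (one for each component). The *search path* of $x$ in $T$ is the path of $T$ from the root to $x$, and $\mathrm{depth}_T(x)$ is its number of nodes. A *rotation at* a node $x$ with parent $p$ swaps $x$ and $p$; the child $y$ of $x$ (if any) whose subtree contains a node adjacent to $p$ in $S$ becomes a child of $p$; all other children of $x$ and $p$ keep their parent. A node $z$ *separates* $x$ and $y$ if $x$ and $y$ lie in different components of $S\setminus z$. The *convex hull* $\mathrm{ch}(A)$ of $A\subseteq V(S)$ is the subtree of $S$ induced by the union of all paths between nodes of $A$. The set $A$ is *Steiner-closed* if every node of $\mathrm{ch}(A)\setminus A$ is adjacent to exactly two nodes of $\mathrm{ch}(A)$; a search tree is *Steiner-closed* if the node set of each of its search paths is Steiner-closed. A node of the search path $P$ of $x$ is *branching* if its degree in $\mathrm{ch}(P)$ is greater than $2$. *Cost model.* For $X=(x_1,\dots,x_m)\in V(S)^m$, serving $X$ in a static search tree $T$ costs $\sum_{i=1}^m\mathrm{depth}_T(x_i)$,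 and $\mathrm{OPT}(X)$ is the minimum of this cost over all search trees $T$ on $S$. In the dynamic model a pointer starts each search at the root of the current tree; moving the pointer to the parent or to a child of the current node, and rotating the edge between the node at the pointer and its parent, cost $1$ each, and every search costs an additional $1$. *SplayTT.* The procedure $\mathrm{splay}(x,y)$ repeats the following while the parent $p$ of $x$ is not $y$ ($y$ may be $\mathit{null}$, meaning "until $x$ is the root"). If the parent of $p$ is $y$, rotate at $x$ (ZIG). Otherwise let $g$ be the parent of $p$; if $p$ separates $x$ and $g$, rotate at $p$ and then at $x$ (ZIG-ZIG); else, if $x$ separates $p$ and $g$, rotate twice at $x$ (ZIG-ZAG). To search $x$, SplayTT moves the pointer from the root to $x$; lets $x_1,\dots,x_k$ be the branching nodes of the search path of $x$, ordered from the root towards $x$, and $x_0=\mathit{null}$; for $i=k,\dots,1$ moves the pointer up to $x_i$ and executes $\mathrm{splay}(x_i,x_{i-1})$; finally it moves the pointer back down to $x$ and executes $\mathrm{splay}(x,\mathit{null})$. **Theorem.** There is an absolute constant $C$ such that for every tree $S$ with $n$ nodes, every Steiner-closed search tree $T_0$ on $S$ and every sequence $X$ of $m$ searches over the nodes of $S$,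 SplayTT started in $T_0$ serves $X$ (every search terminates and performs only legal operations), the resulting tree is again a Steiner-closed search tree on $S$, and the total cost is at most $C\cdot(\mathrm{OPT}(X)+n^2)$. -/

import Mathlib

namespace STT

universe u

variable {V : Type u}

/-! ### Search trees on trees -/

/-- A rooted tree on the node set `V`, encoded by its parent pointers: `T x = some p` means that
`p` is the parent of `x`, and `T x = none` means that `x` is a root. That an encoding really is a
rooted tree (a search tree on `S`) is the predicate `IsSearchTree` below. -/
abbrev ParentMap (V : Type u) : Type u := V → Option V

/-- `K` is the node set of a connected component of the induced subgraph `S[B]`. -/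
def IsComponent (S : SimpleGraph V) (B K : Set V) : Prop :=
  ∃ C : (S.induce B).ConnectedComponent, K = Subtype.val '' C.supp

/-- `IsSearchTreeOn S T r A`: the pointers of `T` form, on the node set `A`, a search tree on `S[A]`
with root `r`. For every connected component `K` of `S[A] \ r`, the root `r` has a child
`child K` in `K`, the root of a search tree on `S[K]`. -/
inductive IsSearchTreeOn (S : SimpleGraph V) (T : ParentMap V) : V → Set V → Prop
  | node (r : V) (A : Set V) (child : Set V → V)
      (root_mem : r ∈ A)
      (parent_child : ∀ K, IsComponent S (A \ {r}) K → T (child K) = some r)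
      (subtree : ∀ K, IsComponent S (A \ {r}) K → IsSearchTreeOn S T (child K) K) :
      IsSearchTreeOn S T r A

/-- `T` is a search tree on the tree `S` (an STT). -/
def IsSearchTree (S : SimpleGraph V) (T : ParentMap V) : Prop :=
  ∃ r, T r = none ∧ IsSearchTreeOn S T r Set.univ

/-- The node set of the search path of `x` in `T`: all nodes reached from `x` by following parent
pointers, including `x` itself. -/
def searchPath (T : ParentMap V) (x : V) : Set V :=
  {a | Relation.ReflTransGen (fun u v => T u = some v) x a}

/-- The node set of the subtree of `T` rooted at `x`. -/
def subtree (T : ParentMap V) (x : V) : Set V :=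
  {y | x ∈ searchPath T y}

/-- The number of nodes on the search path of `x` in `T`; the root has depth `1`. -/
noncomputable def depth (T : ParentMap V) (x : V) : ℕ :=
  (searchPath T x).ncard

/-- The cost of serving the searches `X` in the static tree `T`. -/
noncomputable def staticCost (T : ParentMap V) (X : List V) : ℕ :=
  (X.map (depth T)).sum

/-- The minimum cost of serving `X` in a static search tree on `S`. -/
noncomputable def opt (S : SimpleGraph V) (X : List V) : ℕ :=
  sInf {c | ∃ R : ParentMap V, IsSearchTree S R ∧ c = staticCost R X}

open Classical in
/-- Rotation at the node `x`, i.e. of the edge between `x` and its parent `p`: the nodes `x` and `p`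
swap places, a child `y` of `x` whose subtree contains an `S`-neighbour of `p` becomes a child of
`p`, and all other nodes keep their parent. -/
noncomputable def rotate (S : SimpleGraph V) (T : ParentMap V) (x : V) : ParentMap V :=
  match T x with
  | none => T
  | some p => fun y =>
      if y = x then T p
      else if y = p then some x
      else if T y = some x ∧ ∃ z ∈ subtree T y, S.Adj p z then some p
      else T y

/-! ### Convex hulls, Steiner-closed trees, branching nodes -/

/-- `z` separates `x` and `y` in `S`: they lie in different connected components of `S \ z`. -/
def Separates (S : SimpleGraph V) (z x y : V) : Prop :=
  ∃ (hx : x ≠ z) (hy : y ≠ z),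
    ¬ (S.induce {v | v ≠ z}).Reachable ⟨x, hx⟩ ⟨y, hy⟩

/-- The node set of the convex hull of `A`: the union of all paths of `S` between nodes of `A`. -/
def hull (S : SimpleGraph V) (A : Set V) : Set V :=
  {v | ∃ a ∈ A, ∃ b ∈ A, ∃ w : S.Walk a b, w.IsPath ∧ v ∈ w.support}

/-- The number of nodes of the convex hull of `A` to which `v` is connected. -/
noncomputable def hullDegree (S : SimpleGraph V) (A : Set V) (v : V) : ℕ :=
  (S.neighborSet v ∩ hull S A).ncard

/-- A Steiner-closed set of nodes. -/
def SteinerClosedSet (S : SimpleGraph V) (A : Set V) : Prop :=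
  ∀ v ∈ hull S A \ A, hullDegree S A v = 2

/-- A Steiner-closed tree: the node set of every search path is Steiner-closed. -/
def SteinerClosed (S : SimpleGraph V) (T : ParentMap V) : Prop :=
  ∀ x, SteinerClosedSet S (searchPath T x)

/-- `v` is a branching node on the search path of `x`: its degree in the convex hull of the search
path is more than `2`. -/
def IsBranching (S : SimpleGraph V) (T : ParentMap V) (x v : V) : Prop :=
  v ∈ searchPath T x ∧ 2 < hullDegree S (searchPath T x) v

/-! ### The dynamic model -/

/-- A state of the dynamic model: the current search tree and the position of the pointer. -/
structure State (V : Type u) where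
  tree : ParentMap V
  ptr : V

/-- The unit-cost operations: moving the pointer to the parent, moving it to the child `c`, and
rotating the edge between the node at the pointer and its parent. -/
inductive Op (V : Type u) where
  | up : Op V
  | down (c : V) : Op V
  | rot : Op V

/-- `Step S s o s'`: the operation `o` can be performed in the state `s` and leads to `s'`. -/
inductive Step (S : SimpleGraph V) : State V → Op V → State V → Prop
  | up (T : ParentMap V) (x p : V) : T x = some p → Step S ⟨T, x⟩ Op.up ⟨T, p⟩
  | down (T : ParentMap V) (x c : V) : T c = some x → Step S ⟨T, x⟩ (Op.down c) ⟨T, c⟩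
  | rot (T : ParentMap V) (x p : V) : T x = some p → Step S ⟨T, x⟩ Op.rot ⟨rotate S T x, x⟩

/-- `Run S s l s'`: performing the list `l` of operations one after the other leads from `s`
to `s'`. -/
inductive Run (S : SimpleGraph V) : State V → List (Op V) → State V → Prop
  | nil (s : State V) : Run S s [] s
  | cons {s s₁ s' : State V} {o : Op V} {l : List (Op V)} :
      Step S s o s₁ → Run S s₁ l s' → Run S s (o :: l) s'

/-! ### SplayTT

Each procedure is given by its terminating executions: the state before, the list of operations
performed, the state after. -/

/-- Move the pointer upwards, from parent to parent, until it is at `a`. -/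
inductive GoUp (S : SimpleGraph V) (a : V) : State V → List (Op V) → State V → Prop
  | arrived (s : State V) : s.ptr = a → GoUp S a s [] s
  | move {s s₁ s' : State V} {l : List (Op V)} :
      s.ptr ≠ a → Step S s Op.up s₁ → GoUp S a s₁ l s' → GoUp S a s (Op.up :: l) s'

/-- Move the pointer downwards, following the search path of `x`, until it is at `x`. -/
inductive GoDown (S : SimpleGraph V) (x : V) : State V → List (Op V) → State V → Prop
  | arrived (s : State V) : s.ptr = x → GoDown S x s [] s
  | move {s s₁ s' : State V} {c : V} {l : List (Op V)} :
      s.ptr ≠ x → c ∈ searchPath s.tree x → Step S s (Op.down c) s₁ → GoDown S x s₁ l s' →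
        GoDown S x s (Op.down c :: l) s'

/-- The procedure splay`(x, y)`, started with the pointer at `x`: while the parent of `x` is not
`y`, perform a ZIG, ZIG-ZIG or ZIG-ZAG step. Here `y = none` stands for `null`. -/
inductive Splay (S : SimpleGraph V) (x : V) (y : Option V) :
    State V → List (Op V) → State V → Prop
  | done (s : State V) : s.ptr = x → s.tree x = y → Splay S x y s [] s
  | zig {s s₁ s' : State V} {l : List (Op V)} {p : V} :
      s.ptr = x → s.tree x = some p → some p ≠ y → s.tree p = y →
      Run S s [Op.rot] s₁ → Splay S x y s₁ l s' →
        Splay S x y s ([Op.rot] ++ l) s'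
  | zigzig {s s₁ s' : State V} {l : List (Op V)} {p g : V} :
      s.ptr = x → s.tree x = some p → some p ≠ y → s.tree p = some g → some g ≠ y →
      Separates S p x g →
      Run S s [Op.up, Op.rot, Op.down x, Op.rot] s₁ → Splay S x y s₁ l s' →
        Splay S x y s ([Op.up, Op.rot, Op.down x, Op.rot] ++ l) s'
  | zigzag {s s₁ s' : State V} {l : List (Op V)} {p g : V} :
      s.ptr = x → s.tree x = some p → some p ≠ y → s.tree p = some g → some g ≠ y →
      ¬ Separates S p x g → Separates S x p g →
      Run S s [Op.rot, Op.rot] s₁ → Splay S x y s₁ l s' →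
        Splay S x y s ([Op.rot, Op.rot] ++ l) s'

/-- `bs` lists the branching nodes on the search path of `x` in `T`, from `x` towards the root. -/
def IsBranchingList (S : SimpleGraph V) (T : ParentMap V) (x : V) (bs : List V) : Prop :=
  (∀ v, v ∈ bs ↔ IsBranching S T x v) ∧
    bs.Pairwise (fun lower upper => upper ≠ lower ∧ upper ∈ searchPath T lower)

/-- Phase 1: for each node of the list in turn, move the pointer to it and splay it until its parent
is the next node of the list (until it is the root, if it is the last one). -/
inductive PhaseOne (S : SimpleGraph V) : List V → State V → List (Op V) → State V → Prop
  | nil (s : State V) : PhaseOne S [] s [] s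
  | cons {b : V} {bs : List V} {s s₁ s₂ s' : State V} {l₁ l₂ l₃ : List (Op V)} :
      GoUp S b s l₁ s₁ → Splay S b bs.head? s₁ l₂ s₂ → PhaseOne S bs s₂ l₃ s' →
        PhaseOne S (b :: bs) s (l₁ ++ l₂ ++ l₃) s'

/-- The operation search`(x)` of SplayTT, executed on the tree `T` with the pointer initially at the
root, performs the operations `ops` and leaves the tree `T'`: follow the search path of `x`; splay
the branching nodes of the search path from bottom to top (phase 1); return to `x` and splay it to
the root (phase 2). -/
def Search (S : SimpleGraph V) (x : V) (T : ParentMap V) (ops : List (Op V))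
    (T' : ParentMap V) : Prop :=
  ∃ (r : V) (bs : List V) (s₀ s₁ s₂ s₃ : State V) (l₀ l₁ l₂ l₃ : List (Op V)),
    T r = none ∧
    GoDown S x ⟨T, r⟩ l₀ s₀ ∧
    IsBranchingList S T x bs ∧
    PhaseOne S bs s₀ l₁ s₁ ∧
    GoDown S x s₁ l₂ s₂ ∧
    Splay S x none s₂ l₃ s₃ ∧
    ops = l₀ ++ l₁ ++ l₂ ++ l₃ ∧
    T' = s₃.tree

/-- `Serve S T X c T'`: SplayTT, started in the tree `T`, serves the searches `X` with total cost `c`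
and final tree `T'`. The cost is the number of pointer moves and rotations, plus one per search. -/
inductive Serve (S : SimpleGraph V) : ParentMap V → List V → ℕ → ParentMap V → Prop
  | nil (T : ParentMap V) : Serve S T [] 0 T
  | cons {T T₁ T' : ParentMap V} {x : V} {X : List V} {ops : List (Op V)} {c : ℕ} :
      Search S x T ops T₁ → Serve S T₁ X c T' → Serve S T (x :: X) (ops.length + 1 + c) T'

end STT

namespace STT

open Relation

universe u

variable {V : Type u}

/-! ### Connected node sets -/

section Connectedness

variable {S : SimpleGraph V}

/-! Structure. The outside neighbours in `S` of a subtree of a search tree are ancestors of its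
root, the parent among them. A search tree is Steiner-closed iff each subtree has at most two such
neighbours (`TwoCut.steinerClosed`, `IsSTT.twoCut_of_steinerClosed`). A rotation at `x` with parent
`p` keeps this property unless the cut number drops from two at `p` to one at `x` (`TwoCut.rotate`).
By `IsSTT.isBranching_iff`, the pointers of a search path with such a drop are exactly those into
branching nodes. Hence the stretches between branching nodes are safe. Phase one lifts each
branching node to just below the next one, where its cut number is at most one; afterwards the whole
path of `x` is safe. In a 2-cut tree ZIG-ZIG or ZIG-ZAG always applies, so no splay gets stuck.

Cost. Fix an optimal static tree `R` and let the rank of a node set be its smallest depth in `R`, in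
the role of minus the logarithm of the size. A connected set has a single top node in `R`, and two
disjoint parts cannot both contain it; this gives the inequality `2 * D C + 1 ≤ D A + D B` that
replaces concavity of the logarithm (`IsSTT.isRank_minDepth`). With the sum of the ranks of all
subtrees as potential, every double step raises the potential by at least one, up to three times the
drop in the rank of the subtree of `x` (`double_step`). The drops telescope within a splay
(`splay_spec`), across phase one (`phaseOne_spec`), and again in phase two, to at most the depth of
`x` in `R` each time. The branching nodes cost a constant each, and they end up on the path that
phase two splays, so its double steps pay for them. Thus a search costs a constant times the
potential rise plus the depth of `x` in `R`, and the potential lies between 0 and the square of the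
number of nodes.

The bound concerns every execution, so one execution is constructed and analysed, and the procedures
are shown to be deterministic. -/

theorem connected_singleton (S : SimpleGraph V) (v : V) :
    (S.induce ({v} : Set V)).Connected := by
  have : Subsingleton ({v} : Set V) := inferInstance
  exact ⟨SimpleGraph.Preconnected.of_subsingleton⟩

/-- Used throughout in place of following a path to the first node outside a set. -/
theorem exists_adj_exit {C A : Set V} (hC : (S.induce C).Connected) {a b : V}
    (ha : a ∈ C) (haA : a ∈ A) (hb : b ∈ C) (hbA : b ∉ A) :
    ∃ u ∈ C, ∃ e ∈ C, u ∈ A ∧ e ∉ A ∧ S.Adj u e := by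
  obtain ⟨w⟩ := hC.preconnected ⟨a, ha⟩ ⟨b, hb⟩
  obtain ⟨d, -, h1, h2⟩ := w.exists_boundary_dart (Subtype.val ⁻¹' A) haA hbA
  exact ⟨d.fst, d.fst.2, d.snd, d.snd.2, h1, h2, d.adj⟩

theorem exists_path_in {C : Set V} (hC : (S.induce C).Connected) {a b : V}
    (ha : a ∈ C) (hb : b ∈ C) : ∃ w : S.Walk a b, w.IsPath ∧ ∀ v ∈ w.support, v ∈ C := by
  classical
  obtain ⟨w⟩ := hC.preconnected ⟨a, ha⟩ ⟨b, hb⟩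
  refine ⟨w.toPath.1.map (SimpleGraph.Embedding.induce C).toHom, ?_, ?_⟩
  · exact SimpleGraph.Walk.IsPath.map Subtype.val_injective w.toPath.2
  · intro v hv
    have hv' : v ∈ (w.toPath.1.map (SimpleGraph.Embedding.induce C).toHom).support := hv
    rw [SimpleGraph.Walk.support_map] at hv'
    obtain ⟨z, -, rfl⟩ := List.mem_map.1 hv'
    exact z.2

/-- In a tree, a node outside a connected set has at most one neighbour in the set. -/
theorem adj_unique_of_connected (hS : S.IsAcyclic) {C : Set V} (hC : (S.induce C).Connected)
    {v w w' : V} (hv : v ∉ C) (hw : w ∈ C) (hw' : w' ∈ C) (h : S.Adj v w) (h' : S.Adj v w') :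
    w = w' := by
  obtain ⟨q, hq, hqC⟩ := exists_path_in hC hw hw'
  have h1 : (SimpleGraph.Walk.cons h q).IsPath := by
    rw [SimpleGraph.Walk.cons_isPath_iff]
    exact ⟨hq, fun hv' => hv (hqC _ hv')⟩
  have h2 : (SimpleGraph.Walk.cons h' SimpleGraph.Walk.nil).IsPath := by
    rw [SimpleGraph.Walk.cons_isPath_iff]
    exact ⟨SimpleGraph.Walk.IsPath.nil, by simpa using h'.ne⟩
  have := congrArg (fun p => p.1.snd)
    ((hS.subsingleton_path _ _).elim ⟨_, h1⟩ ⟨_, h2⟩)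
  simpa using this

theorem connected_union {A B : Set V} (hA : (S.induce A).Connected) (hB : (S.induce B).Connected)
    {v : V} (hvA : v ∈ A) (hvB : v ∈ B) : (S.induce (A ∪ B)).Connected :=
  SimpleGraph.induce_union_connected hA.preconnected hB.preconnected ⟨v, hvA, hvB⟩

theorem connected_union_of_adj {A B : Set V} (hA : (S.induce A).Connected)
    (hB : (S.induce B).Connected) {a b : V} (ha : a ∈ A) (hb : b ∈ B) (hab : S.Adj a b) :
    (S.induce (A ∪ B)).Connected :=
  SimpleGraph.connected_induce_union hA.preconnected hB.preconnected ha hb hab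

theorem connected_insert {A : Set V} (hA : (S.induce A).Connected)
    {a b : V} (ha : a ∈ A) (hab : S.Adj b a) : (S.induce (insert b A)).Connected :=
  connected_union_of_adj (connected_singleton S b) hA rfl ha hab

/-- Two nodes that are not separated by `z` lie in a connected set avoiding `z`. -/
theorem exists_connected_of_not_separates {z x y : V} (hx : x ≠ z) (hy : y ≠ z)
    (h : ¬ Separates S z x y) :
    ∃ C : Set V, (S.induce C).Connected ∧ x ∈ C ∧ y ∈ C ∧ z ∉ C := by
  have h' : (S.induce {v | v ≠ z}).Reachable ⟨x, hx⟩ ⟨y, hy⟩ := by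
    by_contra hn
    exact h ⟨hx, hy, hn⟩
  obtain ⟨w⟩ := h'
  let w' := w.map (SimpleGraph.Embedding.induce {v | v ≠ z}).toHom
  refine ⟨{v | v ∈ w'.support}, w'.connected_induce_support, w'.start_mem_support,
    w'.end_mem_support, ?_⟩
  intro hz
  have hz' : z ∈ w'.support := hz
  rw [SimpleGraph.Walk.support_map] at hz'
  obtain ⟨t, -, ht⟩ := List.mem_map.1 hz'
  exact t.2 ht

theorem not_separates_of_connected {C : Set V} (hC : (S.induce C).Connected) {z x y : V}
    (hx : x ∈ C) (hy : y ∈ C) (hz : z ∉ C) : ¬ Separates S z x y := by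
  rintro ⟨hxz, hyz, hn⟩
  have hCz : ∀ v ∈ C, v ∈ {v | v ≠ z} := fun v hv h => hz (h ▸ hv)
  exact hn ((hC.preconnected ⟨x, hx⟩ ⟨y, hy⟩).map (SimpleGraph.induceHomOfLE S hCz).toHom)

end Connectedness

/-! ### Parent maps -/

theorem searchPath_refl (T : ParentMap V) (x : V) : x ∈ searchPath T x := ReflTransGen.refl

theorem mem_subtree_self (T : ParentMap V) (x : V) : x ∈ subtree T x := ReflTransGen.refl

theorem subtree_trans {T : ParentMap V} {x y z : V} (h : z ∈ subtree T y) (h' : y ∈ subtree T x) :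
    z ∈ subtree T x := ReflTransGen.trans h h'

theorem mem_subtree_of_parent {T : ParentMap V} {x p : V} (h : T x = some p) :
    x ∈ subtree T p := ReflTransGen.single h

theorem mem_subtree_iff {T : ParentMap V} {y z : V} :
    z ∈ subtree T y ↔ z = y ∨ ∃ q, T z = some q ∧ q ∈ subtree T y := by
  constructor
  · intro h
    rcases ReflTransGen.cases_head h with h | ⟨q, hq, h⟩
    · exact Or.inl h
    · exact Or.inr ⟨q, hq, h⟩
  · rintro (rfl | ⟨q, hq, h⟩)
    · exact mem_subtree_self T z
    · exact ReflTransGen.head hq h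

theorem mem_subtree_iff_of_parent {T : ParentMap V} {y z q : V} (hz : T z = some q) (h : z ≠ y) :
    z ∈ subtree T y ↔ q ∈ subtree T y := by
  rw [mem_subtree_iff]
  constructor
  · rintro (h' | ⟨q', hq', h'⟩)
    · exact absurd h' h
    · rw [hz] at hq'
      cases hq'
      exact h'
  · intro h'
    exact Or.inr ⟨q, hz, h'⟩

theorem exists_child_of_mem_subtree {T : ParentMap V} {y z : V} (h : z ∈ subtree T y)
    (hne : z ≠ y) : ∃ c, T c = some y ∧ z ∈ subtree T c := by
  rcases ReflTransGen.cases_tail h with h | ⟨c, hc, h⟩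
  · exact absurd h.symm hne
  · exact ⟨c, h, hc⟩

theorem subtree_comparable {T : ParentMap V} {x y z : V} (hx : z ∈ subtree T x)
    (hy : z ∈ subtree T y) : y ∈ subtree T x ∨ x ∈ subtree T y := by
  have hU : Relator.RightUnique (fun u v => T u = some v) := by
    intro a b c hb hc
    exact Option.some.inj (hb.symm.trans hc)
  exact (ReflTransGen.total_of_right_unique hU hx hy).symm

/-- `T` has a root, which is an ancestor of every node. -/
def Rooted (T : ParentMap V) : Prop := ∃ r, T r = none ∧ ∀ v, v ∈ subtree T r

/-- Acyclicity, by induction from the root downwards: a cycle through a node would also pass through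
its parent. -/
theorem Rooted.parent_notMem {T : ParentMap V} (hT : Rooted T) :
    ∀ {v p : V}, T v = some p → p ∉ subtree T v := by
  obtain ⟨r, hr, h⟩ := hT
  intro v
  refine ReflTransGen.head_induction_on
    (motive := fun v _ => ∀ {p}, T v = some p → p ∉ subtree T v) (h v) ?_ ?_
  · intro p hp
    rw [hr] at hp
    cases hp
  · intro a c hac _ ih p hp hpa
    have hac' : T a = some c := hac
    rw [hac'] at hp
    cases hp
    rcases mem_subtree_iff.1 hpa with rfl | ⟨q, hq, hqa⟩
    · exact ih hac hpa
    · exact ih hq (subtree_trans hqa (mem_subtree_of_parent hac'))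

theorem Rooted.antisymm {T : ParentMap V} (hT : Rooted T) {x y : V} (h : x ∈ subtree T y)
    (h' : y ∈ subtree T x) : x = y := by
  rcases mem_subtree_iff.1 h with h | ⟨q, hq, hqy⟩
  · exact h
  · exact absurd (subtree_trans hqy h') (hT.parent_notMem hq)

theorem Rooted.ne_parent {T : ParentMap V} (hT : Rooted T) {x p : V} (h : T x = some p) : x ≠ p := by
  rintro rfl
  exact hT.parent_notMem h (mem_subtree_self T x)

theorem Rooted.child_unique {T : ParentMap V} (hT : Rooted T) {c c' p z : V} (h : T c = some p)
    (h' : T c' = some p) (hz : z ∈ subtree T c) (hz' : z ∈ subtree T c') : c = c' := by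
  by_contra hne
  rcases subtree_comparable hz hz' with hc | hc
  · rw [mem_subtree_iff_of_parent h' (Ne.symm hne)] at hc
    exact hT.parent_notMem h hc
  · rw [mem_subtree_iff_of_parent h hne] at hc
    exact hT.parent_notMem h' hc

theorem Rooted.root_unique {T : ParentMap V} (hT : Rooted T) {r r' : V} (h : T r = none)
    (h' : T r' = none) : r = r' := by
  obtain ⟨s, hs, hall⟩ := hT
  have key : ∀ q, T q = none → q = s := by
    intro q hq
    rcases mem_subtree_iff.1 (hall q) with h | ⟨p, hp, -⟩
    · exact h
    · rw [hq] at hp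
      cases hp
  rw [key r h, key r' h']

theorem Rooted.mem_subtree_root {T : ParentMap V} (hT : Rooted T) {r : V} (h : T r = none) (v : V) :
    v ∈ subtree T r := by
  obtain ⟨s, hs, hall⟩ := hT
  rw [Rooted.root_unique ⟨s, hs, hall⟩ h hs]
  exact hall v

/-- A family of sets that grows along parent pointers by exactly the current node is the family of
subtrees. -/
theorem subtree_eq_of_closed [Finite V] {T : ParentMap V} {F : V → Set V}
    (h_self : ∀ z, z ∈ F z)
    (h_some : ∀ z q, T z = some q → ∀ y, y ≠ z → (z ∈ F y ↔ q ∈ F y))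
    (h_none : ∀ z, T z = none → ∀ y, z ∈ F y → y = z)
    (h_parent : ∀ z q, T z = some q → q ∉ F z) (y : V) : subtree T y = F y := by
  -- Induction on the number of would-be ancestors of `z`. Passing to its parent `q` decreases it,
  -- since `z` itself is lost by `h_parent`.
  have key : ∀ n z, {y | z ∈ F y}.ncard = n → ∀ y, z ∈ subtree T y ↔ z ∈ F y := by
    intro n
    induction n using Nat.strong_induction_on with
    | _ n ih =>
      intro z hz y
      by_cases hzy : y = z
      · subst hzy
        exact ⟨fun _ => h_self y, fun _ => mem_subtree_self T y⟩
      cases hT : T z with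
      | none =>
        constructor
        · intro h
          rcases mem_subtree_iff.1 h with h | ⟨q, hq, -⟩
          · exact absurd h.symm hzy
          · rw [hT] at hq
            cases hq
        · intro h
          exact absurd (h_none z hT y h) hzy
      | some q =>
        rw [mem_subtree_iff_of_parent hT (Ne.symm hzy), h_some z q hT y hzy]
        refine ih _ ?_ q rfl y
        rw [← hz]
        refine Set.ncard_lt_ncard ?_ (Set.toFinite _)
        refine ⟨fun w hw => ?_, fun hsub => h_parent z q hT (hsub (h_self z))⟩
        by_cases hwz : w = z
        · subst hwz
          exact h_self w
        · exact (h_some z q hT w hwz).2 hw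
  ext z
  exact key _ z rfl y

/-! ### Search trees by subtrees -/

/-- `T` is a rooted tree with connected subtrees in which adjacent nodes of `S` are comparable. -/
structure IsSTT (S : SimpleGraph V) (T : ParentMap V) : Prop where
  rooted : Rooted T
  conn : ∀ v, (S.induce (subtree T v)).Connected
  comp : ∀ u v, S.Adj u v → u ∈ subtree T v ∨ v ∈ subtree T u

/-- The nodes outside `A` that are adjacent to `A`. -/
def boundary (S : SimpleGraph V) (A : Set V) : Set V := {b | b ∉ A ∧ ∃ a ∈ A, S.Adj a b}

/-- The number of nodes outside the subtree of `v` that are adjacent to it. -/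
noncomputable def cutNumber (S : SimpleGraph V) (T : ParentMap V) (v : V) : ℕ :=
  (boundary S (subtree T v)).ncard

/-- Every subtree is adjacent to at most two outside nodes. -/
def TwoCut (S : SimpleGraph V) (T : ParentMap V) : Prop := ∀ v, cutNumber S T v ≤ 2

section IsSTT

variable {S : SimpleGraph V} {T : ParentMap V}

/-- The node `e` is comparable with its neighbour inside the subtree but cannot lie below it, so
both `e` and `v` are ancestors of that neighbour. -/
theorem IsSTT.mem_subtree_of_boundary (hT : IsSTT S T) {v e : V}
    (he : e ∈ boundary S (subtree T v)) : v ∈ subtree T e := by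
  obtain ⟨hn, a, ha, hae⟩ := he
  have hae' : a ∈ subtree T e := by
    rcases hT.comp a e hae with h | h
    · exact h
    · exact absurd (subtree_trans h ha) hn
  rcases subtree_comparable ha hae' with h | h
  · exact absurd h hn
  · exact h

theorem IsSTT.eq_parent_of_boundary (hT : IsSTT S T) {v p e : V} (hv : T v = some p)
    (he : e ∈ boundary S (subtree T v)) (hep : e ∈ subtree T p) : e = p := by
  have hev := hT.mem_subtree_of_boundary he
  have hne : v ≠ e := by
    rintro rfl
    exact he.1 (mem_subtree_self T v)
  rw [mem_subtree_iff_of_parent hv hne] at hev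
  exact hT.rooted.antisymm hep hev

/-- Inside the connected subtree of `p` some edge leaves the subtree of `v`, and its outer end can
only be `p`. In particular only the root has cut number zero. -/
theorem IsSTT.parent_mem_boundary (hT : IsSTT S T) {v p : V} (hv : T v = some p) :
    p ∈ boundary S (subtree T v) := by
  obtain ⟨u, hu, e, he, huv, hev, hue⟩ := exists_adj_exit (hT.conn p)
    (mem_subtree_of_parent hv) (mem_subtree_self T v) (mem_subtree_self T p)
    (hT.rooted.parent_notMem hv)
  have hb : e ∈ boundary S (subtree T v) := ⟨hev, u, huv, hue⟩
  rwa [← hT.eq_parent_of_boundary hv hb he]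

theorem IsSTT.exists_adj_parent (hT : IsSTT S T) {v p : V} (hv : T v = some p) :
    ∃ k ∈ subtree T v, S.Adj p k := by
  obtain ⟨-, k, hk, hkp⟩ := hT.parent_mem_boundary hv
  exact ⟨k, hk, hkp.symm⟩

theorem IsSTT.boundary_subset (hT : IsSTT S T) {v p e : V} (hv : T v = some p)
    (he : e ∈ boundary S (subtree T v)) : e = p ∨ e ∈ boundary S (subtree T p) := by
  by_cases hep : e ∈ subtree T p
  · exact Or.inl (hT.eq_parent_of_boundary hv he hep)
  · obtain ⟨-, a, ha, hae⟩ := he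
    exact Or.inr ⟨hep, a, subtree_trans ha (mem_subtree_of_parent hv), hae⟩

theorem cutNumber_root (hT : Rooted T) {r : V} (hr : T r = none) : cutNumber S T r = 0 := by
  have : boundary S (subtree T r) = ∅ := by
    ext e
    simp only [Set.mem_empty_iff_false, iff_false]
    intro he
    exact he.1 (hT.mem_subtree_root hr e)
  rw [cutNumber, this, Set.ncard_empty]

theorem TwoCut.false_of_three [Finite V] (h2 : TwoCut S T) {v a b c : V}
    (ha : a ∈ boundary S (subtree T v)) (hb : b ∈ boundary S (subtree T v))
    (hc : c ∈ boundary S (subtree T v)) (hab : a ≠ b) (hac : a ≠ c) (hbc : b ≠ c) : False := by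
  have h1 : ({a, b, c} : Set V).ncard = 3 := Set.ncard_eq_three.2 ⟨a, b, c, hab, hac, hbc, rfl⟩
  have h3 : ({a, b, c} : Set V) ⊆ boundary S (subtree T v) := by
    rintro z (rfl | rfl | rfl) <;> assumption
  have h4 := Set.ncard_le_ncard h3 (Set.toFinite _)
  have h5 := h2 v
  rw [cutNumber] at h5
  omega

end IsSTT

/-! ### Components of induced subgraphs. -/

section Components

variable {S : SimpleGraph V} {B K K' : Set V}

theorem exists_isComponent (S : SimpleGraph V) {v : V} (hv : v ∈ B) :
    ∃ K, IsComponent S B K ∧ v ∈ K :=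
  ⟨_, ⟨(S.induce B).connectedComponentMk ⟨v, hv⟩, rfl⟩, ⟨v, hv⟩, rfl, rfl⟩

theorem IsComponent.subset (h : IsComponent S B K) : K ⊆ B := by
  obtain ⟨C, rfl⟩ := h
  rintro _ ⟨v, -, rfl⟩
  exact v.2

theorem IsComponent.nonempty (h : IsComponent S B K) : K.Nonempty := by
  obtain ⟨C, rfl⟩ := h
  exact C.nonempty_supp.image _

theorem IsComponent.closed (h : IsComponent S B K) {u w : V} (hu : u ∈ K) (hw : w ∈ B)
    (huw : S.Adj u w) : w ∈ K := by
  obtain ⟨C, rfl⟩ := h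
  obtain ⟨u, hu, rfl⟩ := hu
  refine ⟨⟨w, hw⟩, ?_, rfl⟩
  have hadj : (S.induce B).Adj u ⟨w, hw⟩ := huw
  exact (SimpleGraph.ConnectedComponent.connectedComponentMk_eq_of_adj hadj).symm.trans hu

theorem IsComponent.connected (h : IsComponent S B K) : (S.induce K).Connected := by
  classical
  obtain ⟨C, rfl⟩ := h
  obtain ⟨u, hu⟩ := C.nonempty_supp
  refine SimpleGraph.induce_connected_of_patches u.1 ⟨u, hu, rfl⟩ ?_
  rintro _ ⟨v, hv, rfl⟩
  obtain ⟨w⟩ := SimpleGraph.ConnectedComponent.exact (hu.trans hv.symm)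
  let w' := w.map (SimpleGraph.Embedding.induce B).toHom
  refine ⟨{z | z ∈ w'.support}, ?_, w'.start_mem_support, w'.end_mem_support,
    w'.connected_induce_support.preconnected _ _⟩
  intro z hz
  have hz' : z ∈ w'.support := hz
  rw [SimpleGraph.Walk.support_map] at hz'
  obtain ⟨t, ht, rfl⟩ := List.mem_map.1 hz'
  refine ⟨t, ?_, rfl⟩
  have : (S.induce B).Reachable u t := ⟨w.takeUntil t ht⟩
  exact (SimpleGraph.ConnectedComponent.sound this).symm.trans hu

theorem IsComponent.subset_of_connected (h : IsComponent S B K) {C : Set V}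
    (hC : (S.induce C).Connected) (hCB : C ⊆ B) {v : V} (hvC : v ∈ C) (hvK : v ∈ K) : C ⊆ K := by
  intro z hz
  by_contra hzK
  obtain ⟨u, -, e, heC, huK, heK, hue⟩ := exists_adj_exit hC hvC hvK hz hzK
  exact heK (h.closed huK (hCB heC) hue)

theorem IsComponent.eq_of_mem (h : IsComponent S B K) (h' : IsComponent S B K') {v : V}
    (hv : v ∈ K) (hv' : v ∈ K') : K = K' :=
  Set.Subset.antisymm (h'.subset_of_connected h.connected h.subset hv hv')
    (h.subset_of_connected h'.connected h'.subset hv' hv)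

end Components

/-! ### The recursive definition of search trees against the description by subtrees. -/

theorem IsSearchTreeOn.parent_mem {S : SimpleGraph V} {T : ParentMap V} {r : V} {A : Set V}
    (h : IsSearchTreeOn S T r A) : ∀ v ∈ A, v = r ∨ ∃ q ∈ A, T v = some q := by
  induction h with
  | node r A child root_mem parent_child _ ih =>
    intro v hv
    by_cases hvr : v = r
    · exact Or.inl hvr
    obtain ⟨K, hK, hvK⟩ := exists_isComponent S (B := A \ {r}) ⟨hv, hvr⟩
    rcases ih K hK v hvK with h | ⟨q, hq, h⟩
    · exact Or.inr ⟨r, root_mem, h ▸ parent_child K hK⟩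
    · exact Or.inr ⟨q, (hK.subset hq).1, h⟩

/-- `IsSearchTreeOn` constrains only pointers of nodes of `A`. The two pointer hypotheses exclude
pointers entering `A` from outside and a pointer from `r` back into `A`; they are inherited by the
components and are trivial for the whole tree. -/
theorem IsSearchTreeOn.subtree_eq {S : SimpleGraph V} {T : ParentMap V} {r : V} {A : Set V}
    (h : IsSearchTreeOn S T r A) : (S.induce A).Connected →
    (∀ y q, T y = some q → q ∈ A → y ∈ A) → (∀ q, T r = some q → q ∉ A) →
    subtree T r = A ∧ (∀ v ∈ A, (S.induce (subtree T v)).Connected) ∧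
      ∀ u ∈ A, ∀ v ∈ A, S.Adj u v → u ∈ subtree T v ∨ v ∈ subtree T u := by
  induction h with
  | node r A child root_mem parent_child sub ih =>
    intro hA hclosed hroot
    have hparent : ∀ K, IsComponent S (A \ {r}) K → ∀ v ∈ K, T v = some r ∨ ∃ q ∈ K, T v = some q := by
      intro K hK v hv
      rcases (sub K hK).parent_mem v hv with h | h
      · exact Or.inl (h ▸ parent_child K hK)
      · exact Or.inr h
    have ih' : ∀ K, IsComponent S (A \ {r}) K → _ := fun K hK => ih K hK hK.connected
      (by
        intro y q hyq hq
        have hyA : y ∈ A := hclosed y q hyq (hK.subset hq).1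
        have hyr : y ≠ r := by
          rintro rfl
          exact hroot q hyq (hK.subset hq).1
        obtain ⟨K', hK', hyK'⟩ := exists_isComponent S (B := A \ {r}) ⟨hyA, hyr⟩
        rcases hparent K' hK' y hyK' with h | ⟨q', hq', h⟩
        · rw [hyq] at h
          cases h
          exact absurd rfl (hK.subset hq).2
        · rw [hyq] at h
          cases h
          rwa [hK.eq_of_mem hK' hq hq'])
      (by
        intro q hq hqK
        rw [parent_child K hK] at hq
        cases hq
        exact (hK.subset hqK).2 rfl)
    have hr : subtree T r = A := by
      ext v
      constructor
      · intro hv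
        refine ReflTransGen.head_induction_on (motive := fun v _ => v ∈ A) hv root_mem ?_
        intro a c hac _ hc
        exact hclosed a c hac hc
      · intro hv
        by_cases hvr : v = r
        · subst hvr
          exact mem_subtree_self T v
        obtain ⟨K, hK, hvK⟩ := exists_isComponent S (B := A \ {r}) ⟨hv, hvr⟩
        rw [← (ih' K hK).1] at hvK
        exact subtree_trans hvK (mem_subtree_of_parent (parent_child K hK))
    refine ⟨hr, ?_, ?_⟩
    · intro v hv
      by_cases hvr : v = r
      · subst hvr
        rwa [hr]
      obtain ⟨K, hK, hvK⟩ := exists_isComponent S (B := A \ {r}) ⟨hv, hvr⟩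
      exact (ih' K hK).2.1 v hvK
    · intro u hu v hv huv
      by_cases hur : u = r
      · subst hur
        rw [hr]
        exact Or.inr hv
      by_cases hvr : v = r
      · subst hvr
        rw [hr]
        exact Or.inl hu
      obtain ⟨K, hK, huK⟩ := exists_isComponent S (B := A \ {r}) ⟨hu, hur⟩
      exact (ih' K hK).2.2 u huK v (hK.closed huK ⟨hv, hvr⟩ huv) huv

theorem IsSearchTree.isSTT {S : SimpleGraph V} {T : ParentMap V} (hS : S.Connected)
    (h : IsSearchTree S T) : IsSTT S T := by
  obtain ⟨r, hr, h⟩ := h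
  have hU : (S.induce (Set.univ : Set V)).Connected :=
    (SimpleGraph.induceUnivIso S).connected_iff.2 hS
  obtain ⟨h1, h2, h3⟩ := h.subtree_eq hU (fun _ _ _ _ => Set.mem_univ _)
    (fun q hq => by rw [hr] at hq; cases hq)
  exact ⟨⟨r, hr, fun v => h1 ▸ Set.mem_univ v⟩, fun v => h2 v (Set.mem_univ v),
    fun u v => h3 u (Set.mem_univ u) v (Set.mem_univ v)⟩

theorem IsSTT.component_eq_subtree {S : SimpleGraph V} {T : ParentMap V} (hT : IsSTT S T) {v : V}
    {K : Set V} (hK : IsComponent S (subtree T v \ {v}) K) : ∃ c, T c = some v ∧ subtree T c = K := by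
  obtain ⟨x, hx⟩ := hK.nonempty
  obtain ⟨c, hc, hxc⟩ := exists_child_of_mem_subtree (hK.subset hx).1 (hK.subset hx).2
  refine ⟨c, hc, Set.Subset.antisymm ?_ ?_⟩
  · refine hK.subset_of_connected (hT.conn c) ?_ hxc hx
    intro z hz
    refine ⟨subtree_trans hz (mem_subtree_of_parent hc), ?_⟩
    rintro rfl
    exact hT.rooted.parent_notMem hc hz
  · intro z hz
    by_contra hzc
    obtain ⟨u, -, e, he, huc, hec, hue⟩ := exists_adj_exit hK.connected hx hxc hz hzc
    exact (hK.subset he).2 (hT.eq_parent_of_boundary hc ⟨hec, u, huc, hue⟩ (hK.subset he).1)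

theorem IsSTT.isSearchTreeOn [Finite V] {S : SimpleGraph V} {T : ParentMap V} (hT : IsSTT S T) :
    ∀ n v, (subtree T v).ncard = n → IsSearchTreeOn S T v (subtree T v) := by
  classical
  intro n
  induction n using Nat.strong_induction_on with
  | _ n ih =>
    intro v hv
    -- On sets that are not components the value `v` of `child` is an arbitrary default.
    refine IsSearchTreeOn.node v _
      (fun K => if h : ∃ c, T c = some v ∧ subtree T c = K then h.choose else v)
      (mem_subtree_self T v) ?_ ?_
    · intro K hK
      have h := hT.component_eq_subtree hK
      simp only [dif_pos h]
      exact h.choose_spec.1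
    · intro K hK
      have h := hT.component_eq_subtree hK
      simp only [dif_pos h]
      obtain ⟨h1, h2⟩ := h.choose_spec
      have key := ih (subtree T h.choose).ncard ?_ h.choose rfl
      · rwa [h2] at key
      · rw [← hv]
        refine Set.ncard_lt_ncard ⟨fun z hz => subtree_trans hz (mem_subtree_of_parent h1), ?_⟩
          (Set.toFinite _)
        intro hsub
        exact hT.rooted.parent_notMem h1 (hsub (mem_subtree_self T v))

theorem IsSTT.isSearchTree [Finite V] {S : SimpleGraph V} {T : ParentMap V} (hT : IsSTT S T) :
    IsSearchTree S T := by
  obtain ⟨r, hr, h⟩ := hT.rooted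
  refine ⟨r, hr, ?_⟩
  have hU : subtree T r = Set.univ := Set.eq_univ_of_forall h
  rw [← hU]
  exact hT.isSearchTreeOn _ r rfl

/-! ### Rotations -/

/-- The node set of the subtree of `p` after the rotation at its child `x`. -/
def lowered (S : SimpleGraph V) (T : ParentMap V) (x p : V) : Set V :=
  {z | z ∈ subtree T p ∧
    (z ∈ subtree T x → ∃ c, T c = some x ∧ z ∈ subtree T c ∧ ∃ k ∈ subtree T c, S.Adj p k)}

section Rotate

variable {S : SimpleGraph V} {T : ParentMap V} {x p : V}

theorem rotate_self (hx : T x = some p) : rotate S T x x = T p := by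
  simp [rotate, hx]

theorem rotate_parent (hT : Rooted T) (hx : T x = some p) : rotate S T x p = some x := by
  simp [rotate, hx, (hT.ne_parent hx).symm]

theorem rotate_adopted (hT : Rooted T) (hx : T x = some p) {z k : V} (hz : T z = some x)
    (hk : k ∈ subtree T z) (hpk : S.Adj p k) : rotate S T x z = some p := by
  have h1 : z ≠ x := hT.ne_parent hz
  have h2 : z ≠ p := by
    rintro rfl
    exact hT.parent_notMem hz (mem_subtree_of_parent hx)
  have h3 : ∃ k ∈ subtree T z, S.Adj p k := ⟨k, hk, hpk⟩
  simp only [rotate, hx]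
  rw [if_neg h1, if_neg h2, if_pos ⟨hz, h3⟩]

theorem rotate_other (hx : T x = some p) {z : V} (h1 : z ≠ x) (h2 : z ≠ p)
    (h3 : ¬ (T z = some x ∧ ∃ k ∈ subtree T z, S.Adj p k)) : rotate S T x z = T z := by
  simp only [rotate, hx]
  rw [if_neg h1, if_neg h2, if_neg h3]

theorem rotate_cases (S : SimpleGraph V) (hT : Rooted T) (hx : T x = some p) (z : V) :
    (z = x ∧ rotate S T x z = T p) ∨ (z = p ∧ rotate S T x z = some x) ∨
    (z ≠ x ∧ z ≠ p ∧ T z = some x ∧ (∃ k ∈ subtree T z, S.Adj p k) ∧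
      rotate S T x z = some p) ∨
    (z ≠ x ∧ z ≠ p ∧ ¬ (T z = some x ∧ ∃ k ∈ subtree T z, S.Adj p k) ∧
      rotate S T x z = T z) := by
  by_cases h1 : z = x
  · subst h1
    exact Or.inl ⟨rfl, rotate_self hx⟩
  by_cases h2 : z = p
  · subst h2
    exact Or.inr (Or.inl ⟨rfl, rotate_parent hT hx⟩)
  by_cases h3 : T z = some x ∧ ∃ k ∈ subtree T z, S.Adj p k
  · obtain ⟨hz, k, hk, hpk⟩ := h3
    exact Or.inr (Or.inr (Or.inl ⟨h1, h2, hz, ⟨k, hk, hpk⟩, rotate_adopted hT hx hz hk hpk⟩))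
  · exact Or.inr (Or.inr (Or.inr ⟨h1, h2, h3, rotate_other hx h1 h2 h3⟩))

theorem lowered_subset : lowered S T x p ⊆ subtree T p := fun _ h => h.1

theorem self_mem_lowered (hT : Rooted T) (hx : T x = some p) : p ∈ lowered S T x p :=
  ⟨mem_subtree_self T p, fun h => absurd h (hT.parent_notMem hx)⟩

theorem notMem_lowered (hT : Rooted T) : x ∉ lowered S T x p := by
  rintro ⟨-, h⟩
  obtain ⟨c, hc, hxc, -⟩ := h (mem_subtree_self T x)
  exact hT.parent_notMem hc hxc

theorem lowered_of_parent {z q : V} (hz : T z = some q)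
    (hzx : z ≠ x) (hzp : z ≠ p) (h : ¬ (T z = some x ∧ ∃ k ∈ subtree T z, S.Adj p k)) :
    z ∈ lowered S T x p ↔ q ∈ lowered S T x p := by
  have h1 := mem_subtree_iff_of_parent hz hzp
  have h2 := mem_subtree_iff_of_parent hz hzx
  constructor
  · rintro ⟨hp, hl⟩
    refine ⟨h1.1 hp, fun hq => ?_⟩
    obtain ⟨c, hc, hzc, hk⟩ := hl (h2.2 hq)
    refine ⟨c, hc, ?_, hk⟩
    rwa [← mem_subtree_iff_of_parent hz]
    rintro rfl
    exact h ⟨hc, hk⟩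
  · rintro ⟨hp, hl⟩
    refine ⟨h1.2 hp, fun hq => ?_⟩
    obtain ⟨c, hc, hzc, hk⟩ := hl (h2.1 hq)
    exact ⟨c, hc, subtree_trans (mem_subtree_of_parent hz) hzc, hk⟩

open Classical in
/-- The subtrees after the rotation at `x`, whose parent is `p`. -/
noncomputable def rotatedSubtree (S : SimpleGraph V) (T : ParentMap V) (x p y : V) : Set V :=
  if y = x then subtree T p else if y = p then lowered S T x p else subtree T y

/-- `subtree_eq_of_closed` reduces the claim to local checks at each new pointer: those of `x`, of
`p`, of an adopted child, and of all other nodes. -/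
theorem subtree_rotate_eq [Finite V] (hT : Rooted T) (hx : T x = some p) (y : V) :
    subtree (rotate S T x) y = rotatedSubtree S T x p y := by
  classical
  have hxp : x ≠ p := hT.ne_parent hx
  have hpx : p ∉ subtree T x := hT.parent_notMem hx
  have Fx : rotatedSubtree S T x p x = subtree T p := by simp [rotatedSubtree]
  have Fp : rotatedSubtree S T x p p = lowered S T x p := by simp [rotatedSubtree, hxp.symm]
  have Fo : ∀ y, y ≠ x → y ≠ p → rotatedSubtree S T x p y = subtree T y := by
    intro y h1 h2
    simp [rotatedSubtree, h1, h2]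
  refine subtree_eq_of_closed ?_ ?_ ?_ ?_ y
  · intro z
    by_cases h1 : z = x
    · subst h1
      rw [Fx]
      exact mem_subtree_of_parent hx
    by_cases h2 : z = p
    · subst h2
      rw [Fp]
      exact self_mem_lowered hT hx
    rw [Fo z h1 h2]
    exact mem_subtree_self T z
  · intro z q hzq y hyz
    rcases rotate_cases S hT hx z with ⟨rfl, h⟩ | ⟨rfl, h⟩ | ⟨h1, h2, hz, ⟨k, hk, hpk⟩, h⟩ |
      ⟨h1, h2, h3, h⟩
    · rw [h] at hzq
      by_cases hyp : y = p
      · subst hyp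
        rw [Fp]
        exact iff_of_false (notMem_lowered hT)
          (fun hq => hT.parent_notMem hzq (lowered_subset hq))
      · rw [Fo y hyz hyp, mem_subtree_iff_of_parent hx (Ne.symm hyz),
          mem_subtree_iff_of_parent hzq (Ne.symm hyp)]
    · rw [h] at hzq
      cases hzq
      by_cases hyx : y = x
      · subst hyx
        rw [Fx]
        exact iff_of_true (mem_subtree_self T z) (mem_subtree_of_parent hx)
      · rw [Fo y hyx hyz, mem_subtree_iff_of_parent hx (Ne.symm hyx)]
    · rw [h] at hzq
      cases hzq
      have hzp : z ∈ subtree T p := subtree_trans (mem_subtree_of_parent hz) (mem_subtree_of_parent hx)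
      by_cases hyx : y = x
      · subst hyx
        rw [Fx]
        exact iff_of_true hzp (mem_subtree_self T p)
      by_cases hyp : y = p
      · subst hyp
        rw [Fp]
        exact iff_of_true ⟨hzp, fun _ => ⟨z, hz, mem_subtree_self T z, k, hk, hpk⟩⟩
          (self_mem_lowered hT hx)
      rw [Fo y hyx hyp, mem_subtree_iff_of_parent hz (Ne.symm hyz),
        mem_subtree_iff_of_parent hx (Ne.symm hyx)]
    · rw [h] at hzq
      by_cases hyx : y = x
      · subst hyx
        rw [Fx, mem_subtree_iff_of_parent hzq h2]
      by_cases hyp : y = p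
      · subst hyp
        rw [Fp]
        exact lowered_of_parent hzq h1 h2 h3
      rw [Fo y hyx hyp, mem_subtree_iff_of_parent hzq (Ne.symm hyz)]
  · intro z hz y hzy
    have hself : ∀ {u w : V}, T u = none → u ∈ subtree T w → w = u := by
      intro u w hu huw
      rcases mem_subtree_iff.1 huw with h | ⟨q, hq, -⟩
      · exact h.symm
      · rw [hu] at hq
        cases hq
    rcases rotate_cases S hT hx z with ⟨rfl, h⟩ | ⟨rfl, h⟩ | ⟨h1, h2, -, -, h⟩ | ⟨h1, h2, h3, h⟩
    · rw [h] at hz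
      by_contra hyz
      by_cases hyp : y = p
      · subst hyp
        rw [Fp] at hzy
        exact notMem_lowered hT hzy
      · rw [Fo y hyz hyp, mem_subtree_iff_of_parent hx (Ne.symm hyz)] at hzy
        exact hyp (hself hz hzy)
    · rw [h] at hz
      cases hz
    · rw [h] at hz
      cases hz
    · rw [h] at hz
      by_cases hyx : y = x
      · subst hyx
        rw [Fx] at hzy
        exact absurd (hself hz hzy).symm h2
      by_cases hyp : y = p
      · subst hyp
        rw [Fp] at hzy
        exact absurd (hself hz hzy.1).symm h2
      rw [Fo y hyx hyp] at hzy
      exact hself hz hzy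
  · intro z q hzq
    rcases rotate_cases S hT hx z with ⟨rfl, h⟩ | ⟨rfl, h⟩ | ⟨h1, h2, hz, -, h⟩ | ⟨h1, h2, h3, h⟩
    · rw [h] at hzq
      rw [Fx]
      exact hT.parent_notMem hzq
    · rw [h] at hzq
      cases hzq
      rw [Fp]
      exact notMem_lowered hT
    · rw [h] at hzq
      cases hzq
      rw [Fo z h1 h2]
      exact fun hp => hT.parent_notMem hz (subtree_trans (mem_subtree_of_parent hx) hp)
    · rw [h] at hzq
      rw [Fo z h1 h2]
      exact hT.parent_notMem hzq

theorem subtree_rotate_self [Finite V] (hT : Rooted T) (hx : T x = some p) :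
    subtree (rotate S T x) x = subtree T p := by
  simp [subtree_rotate_eq hT hx, rotatedSubtree]

theorem subtree_rotate_parent [Finite V] (hT : Rooted T) (hx : T x = some p) :
    subtree (rotate S T x) p = lowered S T x p := by
  simp [subtree_rotate_eq hT hx, rotatedSubtree, (hT.ne_parent hx).symm]

theorem subtree_rotate_other [Finite V] (hT : Rooted T) (hx : T x = some p) {y : V} (h1 : y ≠ x)
    (h2 : y ≠ p) : subtree (rotate S T x) y = subtree T y := by
  simp [subtree_rotate_eq hT hx, rotatedSubtree, h1, h2]

theorem Rooted.rotate [Finite V] (hT : Rooted T) (hx : T x = some p) :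
    Rooted (rotate S T x) := by
  obtain ⟨r, hr, hall⟩ := id hT
  have hrx : r ≠ x := by
    rintro rfl
    rw [hr] at hx
    cases hx
  by_cases hrp : r = p
  · subst hrp
    refine ⟨x, (rotate_self hx).trans hr, fun v => ?_⟩
    rw [subtree_rotate_self hT hx]
    exact hall v
  · refine ⟨r, (rotate_other hx hrx hrp ?_).trans hr, fun v => ?_⟩
    · rintro ⟨h, -⟩
      rw [hr] at h
      cases h
    · rw [subtree_rotate_other hT hx hrx hrp]
      exact hall v

/-- Apart from `p` itself, the set is a union of subtrees adjacent to `p`: its other old children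
and the adopted ones. Each of them together with `p` is a connected patch. -/
theorem IsSTT.connected_lowered (hT : IsSTT S T) (hx : T x = some p) :
    (S.induce (lowered S T x p)).Connected := by
  refine SimpleGraph.induce_connected_of_patches p (self_mem_lowered hT.rooted hx) ?_
  have patch : ∀ c z, z ∈ subtree T c → subtree T c ⊆ lowered S T x p →
      (∃ k ∈ subtree T c, S.Adj p k) →
      ∃ s' ⊆ lowered S T x p, ∃ (hu' : p ∈ s') (hv' : z ∈ s'),
        (S.induce s').Reachable ⟨p, hu'⟩ ⟨z, hv'⟩ := by
    rintro c z hz hsub ⟨k, hk, hpk⟩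
    refine ⟨insert p (subtree T c), ?_, Set.mem_insert _ _, Set.mem_insert_of_mem _ hz,
      (connected_insert (hT.conn c) hk hpk).preconnected _ _⟩
    rintro w (rfl | hw)
    · exact self_mem_lowered hT.rooted hx
    · exact hsub hw
  intro z hz
  by_cases hzx : z ∈ subtree T x
  · obtain ⟨c, hc, hzc, hk⟩ := hz.2 hzx
    refine patch c z hzc ?_ hk
    intro w hw
    exact ⟨subtree_trans hw (subtree_trans (mem_subtree_of_parent hc) (mem_subtree_of_parent hx)),
      fun _ => ⟨c, hc, hw, hk⟩⟩
  by_cases hzp : z = p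
  · subst hzp
    exact ⟨{z}, by simpa using hz, rfl, rfl, SimpleGraph.Reachable.refl _⟩
  obtain ⟨c, hc, hzc⟩ := exists_child_of_mem_subtree hz.1 hzp
  refine patch c z hzc ?_ (hT.exists_adj_parent hc)
  intro w hw
  refine ⟨subtree_trans hw (mem_subtree_of_parent hc), fun hwx => ?_⟩
  rw [hT.rooted.child_unique hc hx hw hwx] at hzc
  exact absurd hzc hzx

theorem IsSTT.rotate [Finite V] (hT : IsSTT S T) (hx : T x = some p) :
    IsSTT S (rotate S T x) := by
  have hR := hT.rooted
  refine ⟨hR.rotate hx, ?_, ?_⟩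
  · intro v
    by_cases h1 : v = x
    · subst h1
      rw [subtree_rotate_self hR hx]
      exact hT.conn p
    by_cases h2 : v = p
    · subst h2
      rw [subtree_rotate_parent hR hx]
      exact hT.connected_lowered hx
    rw [subtree_rotate_other hR hx h1 h2]
    exact hT.conn v
  · have key : ∀ u w, S.Adj u w → u ∈ subtree T w →
        u ∈ subtree (STT.rotate S T x) w ∨ w ∈ subtree (STT.rotate S T x) u := by
      intro u w huw hu
      by_cases h1 : w = x
      · subst h1
        rw [subtree_rotate_self hR hx]
        exact Or.inl (subtree_trans hu (mem_subtree_of_parent hx))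
      by_cases h2 : w = p
      · subst h2
        by_cases hux : u ∈ subtree T x
        · by_cases h3 : u = x
          · subst h3
            rw [subtree_rotate_self hR hx]
            exact Or.inr (mem_subtree_self T w)
          obtain ⟨c, hc, huc⟩ := exists_child_of_mem_subtree hux h3
          rw [subtree_rotate_parent hR hx]
          exact Or.inl ⟨hu, fun _ => ⟨c, hc, huc, u, huc, huw.symm⟩⟩
        · rw [subtree_rotate_parent hR hx]
          exact Or.inl ⟨hu, fun h => absurd h hux⟩
      rw [subtree_rotate_other hR hx h1 h2]
      exact Or.inl hu
    intro u w huw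
    rcases hT.comp u w huw with h | h
    · exact key u w huw h
    · exact (key w u huw.symm h).symm

theorem cutNumber_rotate_self [Finite V] (hT : Rooted T) (hx : T x = some p) :
    cutNumber S (rotate S T x) x = cutNumber S T p := by
  rw [cutNumber, subtree_rotate_self hT hx, cutNumber]

theorem cutNumber_rotate_other [Finite V] (hT : Rooted T) (hx : T x = some p) {y : V} (h1 : y ≠ x)
    (h2 : y ≠ p) : cutNumber S (rotate S T x) y = cutNumber S T y := by
  rw [cutNumber, subtree_rotate_other hT hx h1 h2, cutNumber]

theorem IsSTT.boundary_lowered [Finite V] (hT : IsSTT S T) (hx : T x = some p) {e : V}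
    (he : e ∈ boundary S (lowered S T x p)) : e = x ∨ e ∈ boundary S (subtree T p) := by
  have h := (hT.rotate hx).boundary_subset (rotate_parent hT.rooted hx) (e := e)
  rw [subtree_rotate_parent hT.rooted hx, subtree_rotate_self hT.rooted hx] at h
  exact h he

/-- Only the new subtree of `p` is at risk, as it gains the outside neighbour `x`. If there were two
already, the subtree of `x` has an outside neighbour `e` other than `p`, and `e` is lost in
exchange. -/
theorem TwoCut.rotate [Finite V] (hS : S.IsAcyclic) (hT : IsSTT S T) (h2 : TwoCut S T)
    (hx : T x = some p) (hcut : cutNumber S T p = 2 → cutNumber S T x = 2) :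
    TwoCut S (rotate S T x) := by
  have hR := hT.rooted
  intro v
  by_cases h1 : v = x
  · subst h1
    rw [cutNumber_rotate_self hR hx]
    exact h2 p
  by_cases hvp : v = p
  swap
  · rw [cutNumber_rotate_other hR hx h1 hvp]
    exact h2 v
  subst hvp
  rw [cutNumber, subtree_rotate_parent hR hx]
  by_cases hle : cutNumber S T v ≤ 1
  · have hsub : boundary S (lowered S T x v) ⊆ insert x (boundary S (subtree T v)) := by
      intro e he
      rcases hT.boundary_lowered hx he with h | h
      · exact Or.inl h
      · exact Or.inr h
    have h3 := Set.ncard_le_ncard hsub (Set.toFinite _)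
    have h4 := Set.ncard_insert_le x (boundary S (subtree T v))
    rw [cutNumber] at hle
    omega
  have hv2 : cutNumber S T v = 2 := le_antisymm (h2 v) (by omega)
  have hx2 := hcut hv2
  obtain ⟨e, he, hev⟩ : ∃ e ∈ boundary S (subtree T x), e ≠ v := by
    by_contra hcon
    push Not at hcon
    have h5 : boundary S (subtree T x) ⊆ {v} := fun e he => hcon e he
    have h6 := Set.ncard_le_ncard h5 (Set.toFinite _)
    rw [Set.ncard_singleton] at h6
    rw [cutNumber] at hx2
    omega
  have heb : e ∈ boundary S (subtree T v) := (hT.boundary_subset hx he).resolve_left hev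
  -- By acyclicity `e` has only one neighbour in the old subtree of the parent, and it lies below
  -- `x`. If it moved to the parent, it would lie in a child subtree bordering `x`, the parent and
  -- `e`.
  have heL : e ∉ boundary S (lowered S T x v) := by
    rintro ⟨-, k', hk', hke'⟩
    obtain ⟨-, k, hk, hke⟩ := he
    have hkk : k = k' := adj_unique_of_connected hS (hT.conn v) heb.1
      (subtree_trans hk (mem_subtree_of_parent hx)) hk'.1 hke.symm hke'.symm
    subst hkk
    obtain ⟨c, hc, hkc, j, hj, hvj⟩ := hk'.2 hk
    have hec : e ∉ subtree T c := fun h => heb.1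
      (subtree_trans h (subtree_trans (mem_subtree_of_parent hc) (mem_subtree_of_parent hx)))
    have hvc : v ∉ subtree T c := fun h =>
      hR.parent_notMem hx (subtree_trans h (mem_subtree_of_parent hc))
    refine h2.false_of_three (hT.parent_mem_boundary hc) (b := v) (c := e) ⟨hvc, j, hj, hvj.symm⟩
      ⟨hec, k, hkc, hke⟩ (Ne.symm h1) ?_ hev.symm
    rintro rfl
    exact heb.1 (mem_subtree_of_parent hx)
  have hsub : boundary S (lowered S T x v) ⊆ insert x (boundary S (subtree T v) \ {e}) := by
    intro f hf
    rcases hT.boundary_lowered hx hf with h | h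
    · exact Or.inl h
    · refine Or.inr ⟨h, ?_⟩
      rintro rfl
      exact heL hf
  have h3 := Set.ncard_le_ncard hsub (Set.toFinite _)
  have h4 := Set.ncard_insert_le x (boundary S (subtree T v) \ {e})
  have h5 := Set.ncard_sdiff_singleton_add_one heb (Set.toFinite _)
  rw [cutNumber] at hv2
  omega

theorem disjoint_lowered (hT : Rooted T) {c : V} (hc : T c = some x)
    (hadj : ∀ k ∈ subtree T c, ¬ S.Adj p k) : Disjoint (subtree T c) (lowered S T x p) := by
  rw [Set.disjoint_left]
  intro z hz hl
  obtain ⟨c', hc', hzc', k, hk, hpk⟩ := hl.2 (subtree_trans hz (mem_subtree_of_parent hc))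
  rw [← hT.child_unique hc hc' hz hzc'] at hk
  exact hadj k hk hpk

end Rotate

/-! ### Locality of rotations -/

section Local

variable {S : SimpleGraph V} {T : ParentMap V} {x p : V}

theorem rotate_outside [Finite V] (hT : Rooted T) (hx : T x = some p) {z : V}
    (hz : z ∉ subtree T p) :
    rotate S T x z = T z ∧ subtree (rotate S T x) z = subtree T z := by
  have h1 : z ≠ x := by
    rintro rfl
    exact hz (mem_subtree_of_parent hx)
  have h2 : z ≠ p := by
    rintro rfl
    exact hz (mem_subtree_self T z)
  refine ⟨rotate_other hx h1 h2 ?_, subtree_rotate_other hT hx h1 h2⟩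
  rintro ⟨h, -⟩
  exact hz (subtree_trans (mem_subtree_of_parent h) (mem_subtree_of_parent hx))

theorem rotate_inside [Finite V] (hT : Rooted T) (hx : T x = some p) {c z : V} (hc : T c = some x)
    (hadj : ∀ k ∈ subtree T c, ¬ S.Adj p k) (hz : z ∈ subtree T c) :
    rotate S T x z = T z ∧ subtree (rotate S T x) z = subtree T z := by
  have h1 : z ≠ x := by
    rintro rfl
    exact hT.parent_notMem hc hz
  have h2 : z ≠ p := by
    rintro rfl
    exact hT.parent_notMem hx (subtree_trans hz (mem_subtree_of_parent hc))
  refine ⟨?_, subtree_rotate_other hT hx h1 h2⟩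
  refine rotate_other hx h1 h2 ?_
  rintro ⟨h, k, hk, hpk⟩
  rw [hT.child_unique h hc (mem_subtree_self T z) hz] at hk
  exact hadj k hk hpk

theorem IsSTT.not_adj_of_cutNumber_le_one [Finite V] (hT : IsSTT S T) {c q : V} (hc : T c = some x)
    (hcut : cutNumber S T c ≤ 1) (hq : q ∉ subtree T c) (hqx : q ≠ x) :
    ∀ k ∈ subtree T c, ¬ S.Adj q k := by
  intro k hk hqk
  have h1 : q ∈ boundary S (subtree T c) := ⟨hq, k, hk, hqk.symm⟩
  rw [cutNumber, Set.ncard_le_one_iff (Set.toFinite _)] at hcut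
  exact hqx (hcut h1 (hT.parent_mem_boundary hc))

theorem IsSTT.not_adj_of_separates (hT : IsSTT S T) {g : V} (hx : T x = some p)
    (hg : g ≠ p) (h : Separates S p x g) : ∀ k ∈ subtree T x, ¬ S.Adj g k := by
  intro k hk hgk
  refine not_separates_of_connected (connected_insert (hT.conn x) hk hgk)
    (Set.mem_insert_of_mem _ (mem_subtree_self T x)) (Set.mem_insert _ _) ?_ h
  rintro (h | h)
  · exact hg h.symm
  · exact hT.rooted.parent_notMem hx h

/-- In a 2-cut tree, one of the ZIG-ZIG and ZIG-ZAG steps always applies. -/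
theorem IsSTT.separates_of_not_separates [Finite V] (hS : S.IsAcyclic) (hT : IsSTT S T)
    (h2 : TwoCut S T) {g : V} (hx : T x = some p) (hp : T p = some g)
    (h : ¬ Separates S p x g) : Separates S x p g := by
  have hR := hT.rooted
  have hpx : p ∉ subtree T x := hR.parent_notMem hx
  have hgp : g ∉ subtree T p := hR.parent_notMem hp
  have hgx : g ∉ subtree T x := fun h => hgp (subtree_trans h (mem_subtree_of_parent hx))
  obtain ⟨C, hC, hxC, hgC, hpC⟩ := exists_connected_of_not_separates (hR.ne_parent hx)
    (hR.ne_parent hp).symm h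
  obtain ⟨j, hj, hpj⟩ := hT.exists_adj_parent hx
  obtain ⟨k, hk, hgk⟩ := hT.exists_adj_parent hp
  have hCx := connected_union hC (hT.conn x) hxC (mem_subtree_self T x)
  -- Since `g` and `x` are joined around `p`, an edge from `g` to `p` or into another child subtree
  -- of `p` would close a cycle through `p`.
  have hkx : k ∈ subtree T x := by
    by_cases hkp : k = p
    · subst hkp
      have := adj_unique_of_connected hS hCx (v := k) (not_or.2 ⟨hpC, hpx⟩)
        (Or.inl hgC) (Or.inr hj) hgk.symm hpj
      subst this
      exact absurd hj hgx
    obtain ⟨c, hc, hkc⟩ := exists_child_of_mem_subtree hk hkp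
    obtain ⟨i, hi, hpi⟩ := hT.exists_adj_parent hc
    have hCc := connected_union_of_adj hCx (hT.conn c) (Or.inl hgC) hkc hgk
    have hpc : p ∉ subtree T c := hR.parent_notMem hc
    have := adj_unique_of_connected hS hCc (v := p) (not_or.2 ⟨not_or.2 ⟨hpC, hpx⟩, hpc⟩)
      (Or.inl (Or.inr hj)) (Or.inr hi) hpj hpi
    subst this
    rwa [hR.child_unique hx hc hj hi]
  -- If `p` and `g` are also joined around `x`, acyclicity at `x` forces their neighbours `j` and
  -- `k` into one child subtree of `x`, which then borders the three nodes `x`, `p` and `g`.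
  by_contra hsep
  obtain ⟨C', hC', hpC', hgC', hxC'⟩ := exists_connected_of_not_separates (hR.ne_parent hx).symm
    (fun h : g = x => hgx (h ▸ mem_subtree_self T x)) hsep
  have hpc : ∀ c, T c = some x → p ∉ subtree T c := fun c hc h =>
    hpx (subtree_trans h (mem_subtree_of_parent hc))
  have hgc : ∀ c, T c = some x → g ∉ subtree T c := fun c hc h =>
    hgx (subtree_trans h (mem_subtree_of_parent hc))
  by_cases hjx : j = x
  · subst hjx
    by_cases hkj : k = j
    · subst hkj
      exact (hR.ne_parent hp)
        (adj_unique_of_connected hS hC' hxC' hpC' hgC' hpj.symm hgk.symm)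
    obtain ⟨c, hc, hkc⟩ := exists_child_of_mem_subtree hkx hkj
    obtain ⟨i, hi, hji⟩ := hT.exists_adj_parent hc
    have := adj_unique_of_connected hS (connected_union_of_adj hC' (hT.conn c) hgC' hkc hgk)
      (v := j) (not_or.2 ⟨hxC', hR.parent_notMem hc⟩) (Or.inl hpC') (Or.inr hi) hpj.symm hji
    subst this
    exact hpc c hc hi
  obtain ⟨c', hc', hjc'⟩ := exists_child_of_mem_subtree hj hjx
  obtain ⟨i', hi', hxi'⟩ := hT.exists_adj_parent hc'
  have hC1 := connected_union_of_adj hC' (hT.conn c') hpC' hjc' hpj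
  by_cases hkx' : k = x
  · subst hkx'
    have := adj_unique_of_connected hS hC1 (v := k) (not_or.2 ⟨hxC', hR.parent_notMem hc'⟩)
      (Or.inl hgC') (Or.inr hi') hgk.symm hxi'
    subst this
    exact hgc c' hc' hi'
  obtain ⟨c, hc, hkc⟩ := exists_child_of_mem_subtree hkx hkx'
  obtain ⟨i, hi, hxi⟩ := hT.exists_adj_parent hc
  have hC2 := connected_union_of_adj hC1 (hT.conn c) (Or.inl hgC') hkc hgk
  have hii := adj_unique_of_connected hS hC2 (v := x)
    (not_or.2 ⟨not_or.2 ⟨hxC', hR.parent_notMem hc'⟩, hR.parent_notMem hc⟩)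
    (Or.inl (Or.inr hi')) (Or.inr hi) hxi' hxi
  subst hii
  have hcc := hR.child_unique hc hc' hi hi'
  subst hcc
  refine h2.false_of_three (hT.parent_mem_boundary hc) (b := p) (c := g)
    ⟨hpc c hc, j, hjc', hpj.symm⟩ ⟨hgc c hc, k, hkc, hgk.symm⟩ (hR.ne_parent hx) ?_
    (hR.ne_parent hp)
  rintro rfl
  exact hgx (mem_subtree_self T x)

end Local

/-! ### Potential -/

/-- `D` measures node sets so that smaller sets have larger values, and two disjoint parts of a
connected set cannot both have its value. -/
structure IsRank (S : SimpleGraph V) (D : Set V → ℕ) : Prop where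
  mono : ∀ A B : Set V, A ⊆ B → A.Nonempty → D B ≤ D A
  disjoint : ∀ A B C : Set V, A.Nonempty → B.Nonempty → A ⊆ C → B ⊆ C → Disjoint A B →
    (S.induce C).Connected → 2 * D C + 1 ≤ D A + D B

/-- The sum of the values of all subtrees. -/
noncomputable def potential [Fintype V] (D : Set V → ℕ) (T : ParentMap V) : ℕ :=
  ∑ v, D (subtree T v)

/-- The new subtree of `x` is the old one of `p`, so one summand, that of the old subtree of `x`, is
exchanged for that of the lowered set. -/
theorem potential_rotate [Fintype V] {S : SimpleGraph V} {T : ParentMap V} {x p : V}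
    (D : Set V → ℕ) (hT : Rooted T) (hx : T x = some p) :
    potential D (rotate S T x) + D (subtree T x) = potential D T + D (lowered S T x p) := by
  classical
  have hpx : p ∈ Finset.univ.erase x := by
    simp [(hT.ne_parent hx).symm]
  have split : ∀ f : V → ℕ, ∑ v, f v = f x + (f p + ∑ v ∈ (Finset.univ.erase x).erase p, f v) := by
    intro f
    rw [Finset.add_sum_erase _ _ hpx, Finset.add_sum_erase _ _ (Finset.mem_univ x)]
  have hrest : ∑ v ∈ (Finset.univ.erase x).erase p, D (subtree (rotate S T x) v) =
      ∑ v ∈ (Finset.univ.erase x).erase p, D (subtree T v) := by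
    refine Finset.sum_congr rfl fun v hv => ?_
    simp only [Finset.mem_erase, Finset.mem_univ, and_true] at hv
    rw [subtree_rotate_other hT hx hv.2 hv.1]
  rw [potential, potential, split, split (fun v => D (subtree T v)), hrest,
    subtree_rotate_self hT hx, subtree_rotate_parent hT hx]
  ring

theorem IsRank.subtree_le {S : SimpleGraph V} {D : Set V → ℕ} (hD : IsRank S D) {T : ParentMap V}
    {x y : V} (h : x ∈ subtree T y) : D (subtree T y) ≤ D (subtree T x) :=
  hD.mono _ _ (fun _ hz => subtree_trans hz h) ⟨x, mem_subtree_self T x⟩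

/-! ### Double steps -/

/-- `T'` arises from `T` by moving `x` to the place of its ancestor `g`, where the changes are
confined to the subtree of `g` and do not touch the children of `x` that are adjacent to `x`
only. -/
structure Lifted (S : SimpleGraph V) (T T' : ParentMap V) (x g : V) : Prop where
  stt : IsSTT S T'
  twoCut : TwoCut S T'
  parent : T' x = T g
  subtree : subtree T' x = subtree T g
  outside : ∀ z ∉ STT.subtree T g, T' z = T z ∧ STT.subtree T' z = STT.subtree T z
  inside : ∀ c, T c = some x → cutNumber S T c ≤ 1 → ∀ z ∈ STT.subtree T c,
    T' z = T z ∧ STT.subtree T' z = STT.subtree T z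

section Steps

variable {S : SimpleGraph V} {T : ParentMap V} {x p g : V}

theorem Lifted.rotate [Finite V] (hS : S.IsAcyclic) (hT : IsSTT S T) (h2 : TwoCut S T)
    (hx : T x = some p) (hcut : cutNumber S T p = 2 → cutNumber S T x = 2) :
    Lifted S T (STT.rotate S T x) x p where
  stt := hT.rotate hx
  twoCut := h2.rotate hS hT hx hcut
  parent := rotate_self hx
  subtree := subtree_rotate_self hT.rooted hx
  outside _ hz := rotate_outside hT.rooted hx hz
  inside c hc hc1 _ hz := by
    refine rotate_inside hT.rooted hx hc (hT.not_adj_of_cutNumber_le_one hc hc1 ?_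
      (hT.rooted.ne_parent hx).symm) hz
    exact fun h => hT.rooted.parent_notMem hx (subtree_trans h (mem_subtree_of_parent hc))

theorem Lifted.trans {T' T'' : ParentMap V} {h : V} (h₁ : Lifted S T T' x g)
    (h₂ : Lifted S T' T'' x h) (hgh : g ∈ STT.subtree T h) (hne : h ∉ STT.subtree T g) :
    Lifted S T T'' x h where
  stt := h₂.stt
  twoCut := h₂.twoCut
  parent := h₂.parent.trans (h₁.outside h hne).1
  subtree := h₂.subtree.trans (h₁.outside h hne).2
  outside z hz := by
    have hz' : z ∉ STT.subtree T g := fun h => hz (subtree_trans h hgh)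
    obtain ⟨h3, h4⟩ := h₁.outside z hz'
    rw [← h3, ← h4]
    refine h₂.outside z ?_
    rwa [(h₁.outside h hne).2]
  inside c hc hc1 z hz := by
    obtain ⟨h3, h4⟩ := h₁.inside c hc hc1 z hz
    obtain ⟨h5, h6⟩ := h₁.inside c hc hc1 c (mem_subtree_self T c)
    rw [← h3, ← h4]
    refine h₂.inside c (h5.trans hc) ?_ z (by rwa [h6])
    rwa [cutNumber, h6]

/-- The extra 1 comes from the final subtrees of `p` and `g`: by the separation no node of the
former is adjacent to `g`, so they are disjoint parts of the old subtree of `g`. -/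
theorem zigzag_step [Fintype V] (hS : S.IsAcyclic) {D : Set V → ℕ} (hD : IsRank S D)
    (hT : IsSTT S T) (h2 : TwoCut S T) (hx : T x = some p) (hp : T p = some g)
    (hcx : cutNumber S T p = 2 → cutNumber S T x = 2)
    (hcp : cutNumber S T g = 2 → cutNumber S T p = 2) (hsep : Separates S x p g) :
    ∃ T', Run S ⟨T, x⟩ [Op.rot, Op.rot] ⟨T', x⟩ ∧ Lifted S T T' x g ∧
      potential D T + 3 * D (subtree T g) + 1 ≤ potential D T' + 3 * D (subtree T x) := by
  have hR := hT.rooted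
  have hT₁ := hT.rotate hx
  have L₁ := Lifted.rotate hS hT h2 hx hcx
  have hx₁ : rotate S T x x = some g := (rotate_self hx).trans hp
  have hgp : g ∉ subtree T p := hR.parent_notMem hp
  have hgx : g ≠ x := fun h => hgp (h ▸ mem_subtree_of_parent hx)
  have hgs := (L₁.outside g hgp).2
  have L₂ := Lifted.rotate hS hT₁ L₁.twoCut hx₁ (by
    rw [cutNumber, hgs, cutNumber_rotate_self hR hx]
    exact hcp)
  have hp₁ : rotate S T x p = some x := rotate_parent hR hx
  have hdis := disjoint_lowered hT₁.rooted hp₁ (hT₁.not_adj_of_separates hp₁ hgx hsep)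
  have e1 := potential_rotate (S := S) D hR hx
  have e2 := potential_rotate (S := S) D hT₁.rooted hx₁
  have hlow : subtree (rotate S T x) p = lowered S T x p := subtree_rotate_parent hR hx
  rw [hlow] at hdis
  rw [subtree_rotate_self hR hx] at e2
  have hsub := lowered_subset (S := S) (T := rotate S T x) (x := x) (p := g)
  rw [hgs] at hsub
  have e3 := hD.disjoint _ _ (subtree T g) ⟨p, self_mem_lowered hR hx⟩
    ⟨g, self_mem_lowered hT₁.rooted hx₁⟩
    (fun z hz => subtree_trans (lowered_subset hz) (mem_subtree_of_parent hp)) hsub hdis (hT.conn g)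
  have e4 := hD.subtree_le (mem_subtree_of_parent hx)
  have e5 := hD.subtree_le (mem_subtree_of_parent hp)
  refine ⟨rotate S (rotate S T x) x, ?_, L₁.trans L₂ (mem_subtree_of_parent hp) hgp, ?_⟩
  · exact Run.cons (Step.rot _ _ _ hx) (Run.cons (Step.rot _ _ _ hx₁) (Run.nil _))
  · omega

/-- Here the disjoint parts are the old subtree of `x` and the subtree of `g` after the first
rotation: as `p` separates, `g` has no neighbour below `x` and adopts nothing from there. -/
theorem zigzig_step [Fintype V] (hS : S.IsAcyclic) {D : Set V → ℕ} (hD : IsRank S D)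
    (hT : IsSTT S T) (h2 : TwoCut S T) (hx : T x = some p) (hp : T p = some g)
    (hcx : cutNumber S T p = 2 → cutNumber S T x = 2)
    (hcp : cutNumber S T g = 2 → cutNumber S T p = 2) (hsep : Separates S p x g) :
    ∃ T', Run S ⟨T, x⟩ [Op.up, Op.rot, Op.down x, Op.rot] ⟨T', x⟩ ∧ Lifted S T T' x g ∧
      potential D T + 3 * D (subtree T g) + 1 ≤ potential D T' + 3 * D (subtree T x) := by
  have hR := hT.rooted
  have hT₁ := hT.rotate hp
  have L₁ := Lifted.rotate hS hT h2 hp hcp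
  have hgp : g ∉ subtree T p := hR.parent_notMem hp
  have hgx : g ≠ x := fun h => hgp (h ▸ mem_subtree_of_parent hx)
  have hxp : x ≠ p := hR.ne_parent hx
  have hnadj := hT.not_adj_of_separates hx (hR.ne_parent hp).symm hsep
  have hin := fun {z : V} => rotate_inside (z := z) hR hp hx hnadj
  have hx₁ : rotate S T p x = some p := (hin (mem_subtree_self T x)).1.trans hx
  have hxs : subtree (rotate S T p) x = subtree T x := (hin (mem_subtree_self T x)).2
  have L₂ := Lifted.rotate hS hT₁ L₁.twoCut hx₁ (by
    rw [cutNumber_rotate_self hR hp, cutNumber, cutNumber, hxs]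
    exact fun h => hcx (hcp h))
  have hdis := disjoint_lowered hR hx hnadj
  have e1 := potential_rotate (S := S) D hR hp
  have e2 := potential_rotate (S := S) D hT₁.rooted hx₁
  rw [hxs] at e2
  have hps : subtree (rotate S T p) p = subtree T g := subtree_rotate_self hR hp
  have hsub := lowered_subset (S := S) (T := rotate S T p) (x := x) (p := p)
  rw [hps] at hsub
  have e3 := hD.disjoint _ _ (subtree T g) ⟨x, mem_subtree_self T x⟩
    ⟨g, self_mem_lowered hR hp⟩
    (fun z hz => subtree_trans hz (subtree_trans (mem_subtree_of_parent hx)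
      (mem_subtree_of_parent hp))) lowered_subset hdis (hT.conn g)
  have e4 := hD.subtree_le (mem_subtree_of_parent hx)
  have e5 := hD.mono _ _ hsub ⟨p, self_mem_lowered hT₁.rooted hx₁⟩
  refine ⟨rotate S (rotate S T p) x, ?_, ?_, ?_⟩
  · exact Run.cons (Step.up _ _ _ hx) (Run.cons (Step.rot _ _ _ hp)
      (Run.cons (Step.down _ _ _ hx₁) (Run.cons (Step.rot _ _ _ hx₁) (Run.nil _))))
  · have hout : ∀ z ∉ subtree T g, rotate S (rotate S T p) x z = T z ∧
        subtree (rotate S (rotate S T p) x) z = subtree T z := by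
      intro z hz
      obtain ⟨h3, h4⟩ := L₁.outside z hz
      rw [← h3, ← h4]
      exact L₂.outside z (by rwa [hps])
    refine ⟨L₂.stt, L₂.twoCut, L₂.parent.trans L₁.parent, L₂.subtree.trans L₁.subtree, hout, ?_⟩
    intro c hc hc1 z hz
    have hcx := mem_subtree_of_parent hc
    obtain ⟨h3, h4⟩ := hin (subtree_trans hz hcx)
    obtain ⟨h5, h6⟩ := hin hcx
    rw [← h3, ← h4]
    refine L₂.inside c (h5.trans hc) ?_ z (by rwa [h6])
    rwa [cutNumber, h6]
  · omega

theorem double_step [Fintype V] (hS : S.IsAcyclic) {D : Set V → ℕ} (hD : IsRank S D)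
    (hT : IsSTT S T) (h2 : TwoCut S T) (hx : T x = some p) (hp : T p = some g)
    (hcx : cutNumber S T p = 2 → cutNumber S T x = 2)
    (hcp : cutNumber S T g = 2 → cutNumber S T p = 2) {y : Option V} (hpy : some p ≠ y)
    (hgy : some g ≠ y) :
    ∃ T', Lifted S T T' x g ∧
      potential D T + 3 * D (subtree T g) + 1 ≤ potential D T' + 3 * D (subtree T x) ∧
      ∀ l s', Splay S x y ⟨T', x⟩ l s' →
        ∃ l', Splay S x y ⟨T, x⟩ l' s' ∧ l'.length ≤ l.length + 4 := by
  by_cases hsep : Separates S p x g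
  · obtain ⟨T', hrun, hL, hpot⟩ := zigzig_step hS hD hT h2 hx hp hcx hcp hsep
    refine ⟨T', hL, hpot, fun l s' h => ⟨_, Splay.zigzig rfl hx hpy hp hgy hsep hrun h, ?_⟩⟩
    simp
  · have hsep' := hT.separates_of_not_separates hS h2 hx hp hsep
    obtain ⟨T', hrun, hL, hpot⟩ := zigzag_step hS hD hT h2 hx hp hcx hcp hsep'
    refine ⟨T', hL, hpot, fun l s' h => ⟨_, Splay.zigzag rfl hx hpy hp hgy hsep hsep' hrun h, ?_⟩⟩
    simp

/-! ### Splaying -/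

/-- The `n` pointers from `x` upwards lead to a child of `y` (the root, if `y = none`) that is
adjacent to at most one outside node, and no node of cut number two is followed, downwards, by one
of smaller cut number. -/
inductive MonotonePath (S : SimpleGraph V) (T : ParentMap V) (y : Option V) : ℕ → V → Prop
  | top {x : V} : T x = y → cutNumber S T x ≤ 1 → MonotonePath S T y 0 x
  | step {n : ℕ} {x p : V} : T x = some p → (cutNumber S T p = 2 → cutNumber S T x = 2) →
      MonotonePath S T y n p → MonotonePath S T y (n + 1) x

theorem MonotonePath.mem_subtree {b : V} {n : ℕ} (hT : Rooted T)
    (h : MonotonePath S T (some b) n x) : x ∈ subtree T b ∧ b ∉ subtree T x := by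
  induction h with
  | top h _ => exact ⟨mem_subtree_of_parent h, hT.parent_notMem h⟩
  | step h _ _ ih =>
    exact ⟨subtree_trans (mem_subtree_of_parent h) ih.1,
      fun hb => ih.2 (subtree_trans hb (mem_subtree_of_parent h))⟩

theorem MonotonePath.ne {y : Option V} {n : ℕ} (hT : Rooted T)
    (h : MonotonePath S T y n x) : some x ≠ y := by
  rintro rfl
  exact (h.mem_subtree hT).2 (mem_subtree_self T x)

theorem MonotonePath.congr {T' : ParentMap V} {y : Option V} {n : ℕ} {A : Set V}
    (hA : ∀ z q, T z = some q → q ∈ A → z ∈ A)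
    (hagree : ∀ z ∉ A, T' z = T z ∧ subtree T' z = subtree T z)
    (h : MonotonePath S T y n x) (hx : x ∉ A) : MonotonePath S T' y n x := by
  have hcut : ∀ z ∉ A, cutNumber S T' z = cutNumber S T z := by
    intro z hz
    rw [cutNumber, (hagree z hz).2, cutNumber]
  induction h with
  | top h h1 => exact MonotonePath.top ((hagree _ hx).1.trans h) (by rwa [hcut _ hx])
  | step h h1 _ ih =>
    have hp := fun hp => hx (hA _ _ h hp)
    refine MonotonePath.step ((hagree _ hx).1.trans h) ?_ (ih hp)
    rwa [hcut _ hx, hcut _ hp]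

theorem subtree_closed (T : ParentMap V) (g : V) :
    ∀ z q, T z = some q → q ∈ subtree T g → z ∈ subtree T g :=
  fun _ _ h hq => subtree_trans (mem_subtree_of_parent h) hq

/-- The node `x` takes over the parent and the subtree of `g`, hence its cut number, and the path
above is outside the changed region. -/
theorem MonotonePath.lift {T' : ParentMap V} {y : Option V} {n : ℕ} (hT : Rooted T)
    (hL : Lifted S T T' x g) (h : MonotonePath S T y n g) : MonotonePath S T' y n x := by
  have hcut : cutNumber S T' x = cutNumber S T g := by rw [cutNumber, hL.subtree, cutNumber]
  cases h with
  | top h h1 => exact MonotonePath.top (hL.parent.trans h) (by rwa [hcut])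
  | step h h1 hn =>
    have hp := hT.parent_notMem h
    refine MonotonePath.step (hL.parent.trans h) ?_ (hn.congr (subtree_closed T g) hL.outside hp)
    rwa [hcut, cutNumber, (hL.outside _ hp).2]

/-- `N` counts the double steps, of at most four operations each. The `+ 1` terms stand for a single
final ZIG, which need not gain potential beyond the telescoping rank terms. The last conditions but
one record what is left untouched: everything outside the final subtree of `x`, and the child
subtrees of `x` bordering only `x`. -/
theorem splay_spec [Fintype V] (hS : S.IsAcyclic) {D : Set V → ℕ} (hD : IsRank S D)
    {y : Option V} : ∀ (n : ℕ) (T : ParentMap V), IsSTT S T → TwoCut S T →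
    MonotonePath S T y n x → ∃ (l : List (Op V)) (T' : ParentMap V) (N : ℕ),
      Splay S x y ⟨T, x⟩ l ⟨T', x⟩ ∧ l.length ≤ 4 * N + 1 ∧ n ≤ 2 * N + 1 ∧
      IsSTT S T' ∧ TwoCut S T' ∧ MonotonePath S T' y 0 x ∧ subtree T x ⊆ subtree T' x ∧
      (∀ z ∉ subtree T' x, T' z = T z ∧ subtree T' z = subtree T z) ∧
      (∀ c, T c = some x → cutNumber S T c ≤ 1 → ∀ z ∈ subtree T c,
        T' z = T z ∧ subtree T' z = subtree T z) ∧
      potential D T + 3 * D (subtree T' x) + N ≤ potential D T' + 3 * D (subtree T x) := by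
  intro n
  induction n using Nat.strong_induction_on with
  | _ n ih =>
    intro T hT h2 hpath
    have hR := hT.rooted
    cases hpath with
    | top h h1 =>
      exact ⟨[], T, 0, Splay.done _ rfl h, by simp, by simp, hT, h2, MonotonePath.top h h1,
        Set.Subset.rfl, fun _ _ => ⟨rfl, rfl⟩, fun _ _ _ _ _ => ⟨rfl, rfl⟩, by simp⟩
    | @step n' _ p hx hcx hpath' =>
      cases hpath' with
      | top hp hp1 =>
        have htop : MonotonePath S T y 0 p := MonotonePath.top hp hp1
        have hL := Lifted.rotate hS hT h2 hx hcx
        have e1 := potential_rotate (S := S) D hR hx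
        have e2 := hD.subtree_le (mem_subtree_of_parent hx)
        have e3 := hD.mono _ _ (lowered_subset (S := S) (T := T) (x := x))
          ⟨p, self_mem_lowered hR hx⟩
        refine ⟨[Op.rot] ++ [], rotate S T x, 0, ?_, by simp, by simp, hL.stt, hL.twoCut,
          htop.lift hR hL, ?_, ?_, hL.inside, ?_⟩
        · refine Splay.zig rfl hx (htop.ne hR) hp (Run.cons (Step.rot _ _ _ hx) (Run.nil _))
            (Splay.done _ rfl ?_)
          exact (rotate_self hx).trans hp
        · rw [hL.subtree]
          exact fun z hz => subtree_trans hz (mem_subtree_of_parent hx)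
        · rw [hL.subtree]
          exact hL.outside
        · rw [hL.subtree]
          omega
      | @step m _ g hp hcp hpath'' =>
        obtain ⟨T₁, hL, hpot, hext⟩ := double_step hS hD hT h2 hx hp hcx hcp
          ((MonotonePath.step hp hcp hpath'').ne hR) (hpath''.ne hR)
        obtain ⟨l, T', N, hsplay, hlen, hn, hT', h2', htop', hsub, hout, hin, hpot'⟩ :=
          ih m (by omega) T₁ hL.stt hL.twoCut (hpath''.lift hR hL)
        obtain ⟨l', hsplay', hlen'⟩ := hext l _ hsplay
        rw [hL.subtree] at hsub hpot'
        refine ⟨l', T', N + 1, hsplay', by omega, by omega, hT', h2', htop', ?_, ?_, ?_, by omega⟩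
        · exact fun z hz => hsub (subtree_trans hz (subtree_trans (mem_subtree_of_parent hx)
            (mem_subtree_of_parent hp)))
        · intro z hz
          obtain ⟨h3, h4⟩ := hL.outside z fun h => hz (hsub h)
          rw [← h3, ← h4]
          exact hout z hz
        · intro c hc hc1 z hz
          obtain ⟨h3, h4⟩ := hL.inside c hc hc1 z hz
          obtain ⟨h5, h6⟩ := hL.inside c hc hc1 c (mem_subtree_self T c)
          rw [← h3, ← h4]
          refine hin c (h5.trans hc) ?_ z (by rwa [h6])
          rwa [cutNumber, h6]

end Steps

section

variable {S : SimpleGraph V} {T : ParentMap V} {x : V}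

/-! ### Moving the pointer -/

/-- Following `n` parent pointers from `x` leads to `a`. -/
inductive UpTo (T : ParentMap V) : ℕ → V → V → Prop
  | refl (x : V) : UpTo T 0 x x
  | step {n : ℕ} {x p a : V} : T x = some p → UpTo T n p a → UpTo T (n + 1) x a

theorem UpTo.mem_subtree {n : ℕ} {a : V} (h : UpTo T n x a) : x ∈ subtree T a := by
  induction h with
  | refl x => exact mem_subtree_self T x
  | step h _ ih => exact subtree_trans (mem_subtree_of_parent h) ih

theorem UpTo.exists_last {n : ℕ} {a : V} (h : UpTo T (n + 1) x a) :
    ∃ c, T c = some a ∧ UpTo T n x c := by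
  induction n generalizing x with
  | zero =>
    cases h with
    | step h h' =>
      cases h'
      exact ⟨x, h, UpTo.refl x⟩
  | succ n ih =>
    cases h with
    | step h h' =>
      obtain ⟨c, hc, hpc⟩ := ih h'
      exact ⟨c, hc, UpTo.step h hpc⟩

theorem exists_goDown (hT : Rooted T) {n : ℕ} {a : V} (h : UpTo T n x a) :
    ∃ l, GoDown S x ⟨T, a⟩ l ⟨T, x⟩ ∧ l.length = n := by
  induction n generalizing a with
  | zero =>
    cases h
    exact ⟨[], GoDown.arrived _ rfl, rfl⟩
  | succ n ih =>
    obtain ⟨c, hc, hxc⟩ := h.exists_last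
    obtain ⟨l, hl, hlen⟩ := ih hxc
    refine ⟨Op.down c :: l, GoDown.move ?_ hxc.mem_subtree (Step.down _ _ _ hc) hl, by simp [hlen]⟩
    rintro (rfl : a = x)
    exact hT.parent_notMem hc hxc.mem_subtree

theorem MonotonePath.exists_goUp (hT : Rooted T) {n : ℕ} {b : V}
    (h : MonotonePath S T (some b) n x) :
    ∃ l, GoUp S b ⟨T, x⟩ l ⟨T, b⟩ ∧ l.length = n + 1 := by
  induction h with
  | @top x h h1 =>
    exact ⟨[Op.up], GoUp.move (hT.ne_parent h) (Step.up _ _ _ h) (GoUp.arrived _ rfl), rfl⟩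
  | @step n x p h h1 hp ih =>
    obtain ⟨l, hl, hlen⟩ := ih
    refine ⟨Op.up :: l, GoUp.move ?_ (Step.up _ _ _ h) hl, by simp [hlen]⟩
    rintro (rfl : x = b)
    exact (MonotonePath.step h h1 hp).ne hT rfl

/-! ### Phase one -/

/-- `bs` lists nodes of a search path, upwards, such that between consecutive ones (and from the last
one to the root) there are monotone paths; `M` is the number of pointers from the first node to the
root, plus one. -/
inductive BranchChain (S : SimpleGraph V) (T : ParentMap V) : List V → ℕ → Prop
  | nil : BranchChain S T [] 0
  | cons {b : V} {bs : List V} {m M : ℕ} : MonotonePath S T bs.head? m b →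
      BranchChain S T bs M → BranchChain S T (b :: bs) (m + 1 + M)

theorem mem_of_closed {A : Set V} (hA : ∀ z q, T z = some q → q ∈ A → z ∈ A) {z q : V}
    (hz : z ∈ subtree T q) (hq : q ∈ A) : z ∈ A := by
  refine ReflTransGen.head_induction_on (motive := fun v _ => v ∈ A) hz hq ?_
  intro a c hac _ hc
  exact hA a c hac hc

theorem BranchChain.congr (hT : Rooted T) {T' : ParentMap V} {A : Set V}
    (hA : ∀ z q, T z = some q → q ∈ A → z ∈ A)
    (hagree : ∀ z ∉ A, T' z = T z ∧ subtree T' z = subtree T z) {bs : List V} {M : ℕ}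
    (h : BranchChain S T bs M) (hhead : ∀ b ∈ bs.head?, b ∉ A) : BranchChain S T' bs M := by
  induction h with
  | nil => exact BranchChain.nil
  | @cons b bs m M hm hbs ih =>
    have hb : b ∉ A := hhead b rfl
    refine BranchChain.cons (hm.congr hA hagree hb) (ih ?_)
    intro b' hb' hb'A
    rw [Option.mem_def.1 hb'] at hm
    exact hb (mem_of_closed hA (hm.mem_subtree hT).1 hb'A)

theorem MonotonePath.exists_top_child {n : ℕ} {b : V} (h : MonotonePath S T (some b) n x) :
    ∃ c, T c = some b ∧ cutNumber S T c ≤ 1 ∧ x ∈ subtree T c := by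
  induction h with
  | @top x h h1 => exact ⟨x, h, h1, mem_subtree_self T x⟩
  | step h _ _ ih =>
    obtain ⟨c, hc, hc1, hpc⟩ := ih
    exact ⟨c, hc, hc1, subtree_trans (mem_subtree_of_parent h) hpc⟩

/-- The path of `x` below `b` lies in a child subtree bordering only `b`, so it travels along
unchanged when `b` is splayed. As `b` ends with cut number at most one, the path may be continued
through `b`. -/
theorem MonotonePath.extend (hT : Rooted T) {T' : ParentMap V} {y : Option V} {n : ℕ} {b : V}
    (h : MonotonePath S T (some b) n x) (hb : MonotonePath S T' y 0 b)
    (hin : ∀ c, T c = some b → cutNumber S T c ≤ 1 → ∀ z ∈ subtree T c,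
      T' z = T z ∧ subtree T' z = subtree T z) :
    MonotonePath S T' y (n + 1) x ∧ UpTo T' (n + 1) x b := by
  obtain ⟨c, hc, hc1, hxc⟩ := h.exists_top_child
  have hagree := hin c hc hc1
  have hcut : ∀ z ∈ subtree T c, cutNumber S T' z = cutNumber S T z := by
    intro z hz
    rw [cutNumber, (hagree z hz).2, cutNumber]
  have hb1 : cutNumber S T' b ≤ 1 := by
    cases hb with
    | top _ h => exact h
  induction h with
  | @top x h h1 =>
    have hx := (hagree x hxc).1.trans h
    exact ⟨MonotonePath.step hx (fun h => by omega) hb, UpTo.step hx (UpTo.refl b)⟩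
  | @step n x p h h1 hp ih =>
    have hx := (hagree x hxc).1.trans h
    have hpc : p ∈ subtree T c := by
      refine (mem_subtree_iff_of_parent h ?_).1 hxc
      rintro rfl
      rw [h] at hc
      exact hp.ne hT hc
    obtain ⟨h3, h4⟩ := ih hpc
    refine ⟨MonotonePath.step hx ?_ h3, UpTo.step hx h4⟩
    rwa [hcut x hxc, hcut p hpc]

/-- Invariant: `n` is the length of the safe path of `x` up to the child of the next branching node,
the pointer is at `a`, which is `d` pointers above `x` and `u` below that child. Each branching node
lengthens the safe path by one, and costs one move and possibly one ZIG besides its double steps. -/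
theorem phaseOne_spec [Fintype V] (hS : S.IsAcyclic) {D : Set V → ℕ} (hD : IsRank S D) :
    ∀ (bs : List V) (T : ParentMap V) (a : V) (n d u M K : ℕ), IsSTT S T → TwoCut S T →
      MonotonePath S T bs.head? n x → UpTo T d x a → d ≤ n → MonotonePath S T bs.head? u a →
      BranchChain S T bs M → (∀ b ∈ bs.head?, D (subtree T b) ≤ K) →
      ∃ (l : List (Op V)) (T' : ParentMap V) (a' : V) (N d' : ℕ),
        PhaseOne S bs ⟨T, a⟩ l ⟨T', a'⟩ ∧ IsSTT S T' ∧ TwoCut S T' ∧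
        MonotonePath S T' none (n + bs.length) x ∧ UpTo T' d' x a' ∧ d' ≤ n + bs.length ∧
        l.length ≤ u + 2 * bs.length + 4 * N ∧ M ≤ 2 * N + 2 * bs.length ∧
        potential D T + N ≤ potential D T' + 3 * K := by
  intro bs
  induction bs with
  | nil =>
    intro T a n d u M K hT h2 hx hd hdn _ hM _
    cases hM
    exact ⟨[], T, a, 0, d, PhaseOne.nil _, hT, h2, hx, hd, hdn, by simp, by simp, by simp⟩
  | cons b bs ih =>
    intro T a n d u M K hT h2 hx hd hdn ha hM hK
    cases hM with
    | @cons _ _ m M hm hM =>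
      have hR := hT.rooted
      obtain ⟨l₁, hup, hlen₁⟩ := ha.exists_goUp hR
      obtain ⟨l₂, T₁, N₁, hsplay, hlen₂, hm₁, hT₁, h2₁, htop, hsub, hout, hin, hpot⟩ :=
        splay_spec hS hD m T hT h2 hm
      obtain ⟨hx₁, hup₁⟩ := hx.extend hR htop hin
      have hclosed : ∀ z q, T z = some q → q ∈ subtree T₁ b → z ∈ subtree T₁ b := by
        intro z q hz hq
        by_contra hzb
        exact hzb (subtree_trans (mem_subtree_of_parent ((hout z hzb).1.trans hz)) hq)
      have htopb : T₁ b = bs.head? := by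
        cases htop with
        | top h _ => exact h
      have hM₁ : BranchChain S T₁ bs M := by
        refine hM.congr hR hclosed hout ?_
        intro b' hb'
        rw [Option.mem_def.1 hb'] at htopb
        exact hT₁.rooted.parent_notMem htopb
      -- The pointer stays at `b`, now itself a child of the next branching node, so `u = 0`. The
      -- final rank of the subtree of `b` bounds the initial rank for the next splay, which makes
      -- the rank terms telescope.
      obtain ⟨l₃, T', a', N, d', hph, hT', h2', hx', hd', hdn', hlen, hMN, hpot'⟩ :=
        ih T₁ b (n + 1) (n + 1) 0 M (D (subtree T₁ b)) hT₁ h2₁ hx₁ hup₁ le_rfl htop hM₁ (by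
          intro b' hb'
          rw [Option.mem_def.1 hb'] at htopb
          exact hD.subtree_le (mem_subtree_of_parent htopb))
      have hKb := hK b rfl
      refine ⟨l₁ ++ l₂ ++ l₃, T', a', N₁ + N, d', PhaseOne.cons hup hsplay hph, hT', h2', ?_, hd',
        ?_, ?_, ?_, ?_⟩
      · rw [List.length_cons, show n + (bs.length + 1) = n + 1 + bs.length by omega]
        exact hx'
      · rw [List.length_cons]
        omega
      · simp only [List.length_cons, List.length_append]
        omega
      · rw [List.length_cons]
        omega
      · omega

/-! ### The branching nodes of a search path -/

/-- Induction from the root down to `x`: a pointer along which the cut number drops from two to one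
adds its upper end to the list, and any other pointer lengthens the current monotone stretch. -/
theorem exists_branchChain [Finite V] (hT : IsSTT S T) (h2 : TwoCut S T) {r : V} (hr : T r = none)
    (x : V) : ∃ (bs : List V) (n M : ℕ), MonotonePath S T bs.head? n x ∧ BranchChain S T bs M ∧
      UpTo T (n + M) x r ∧
      (∀ w, w ∈ bs ↔ ∃ c, T c = some w ∧ x ∈ subtree T c ∧ cutNumber S T w = 2 ∧
        cutNumber S T c = 1) ∧
      bs.Pairwise (fun lower upper => upper ≠ lower ∧ upper ∈ searchPath T lower) := by
  have hR := hT.rooted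
  have hx : ReflTransGen (fun u v => T u = some v) x r := hR.mem_subtree_root hr x
  induction hx using ReflTransGen.head_induction_on with
  | refl =>
    refine ⟨[], 0, 0, MonotonePath.top hr ?_, BranchChain.nil, UpTo.refl r, ?_, List.Pairwise.nil⟩
    · rw [cutNumber_root hR hr]
      omega
    · intro w
      simp only [List.not_mem_nil, false_iff, not_exists]
      rintro c ⟨hc, hrc, -⟩
      rw [hR.antisymm hrc (hR.mem_subtree_root hr c)] at hr
      rw [hr] at hc
      cases hc
  | @head a p hap _ ih =>
    obtain ⟨bs, n, M, hp, hM, hup, hmem, hpw⟩ := ih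
    have hap' : T a = some p := hap
    have hmem' : ∀ w, (∃ c, T c = some w ∧ a ∈ subtree T c ∧ cutNumber S T w = 2 ∧
        cutNumber S T c = 1) ↔ (w = p ∧ cutNumber S T p = 2 ∧ cutNumber S T a = 1) ∨ w ∈ bs := by
      intro w
      rw [hmem]
      constructor
      · rintro ⟨c, hc, hac, hw, hc1⟩
        by_cases hne : a = c
        · subst hne
          rw [hap'] at hc
          cases hc
          exact Or.inl ⟨rfl, hw, hc1⟩
        · exact Or.inr ⟨c, hc, (mem_subtree_iff_of_parent hap' hne).1 hac, hw, hc1⟩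
      · rintro (⟨rfl, hw, ha⟩ | ⟨c, hc, hpc, hw, hc1⟩)
        · exact ⟨a, hap', mem_subtree_self T a, hw, ha⟩
        · exact ⟨c, hc, subtree_trans (mem_subtree_of_parent hap') hpc, hw, hc1⟩
    by_cases hcut : cutNumber S T p = 2 ∧ cutNumber S T a = 1
    · refine ⟨p :: bs, 0, n + 1 + M, MonotonePath.top hap' (by omega), BranchChain.cons hp hM, ?_,
        ?_, ?_⟩
      · rw [show 0 + (n + 1 + M) = n + M + 1 by omega]
        exact UpTo.step hap' hup
      · intro w
        rw [hmem', List.mem_cons]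
        simp [hcut]
      · refine List.Pairwise.cons ?_ hpw
        intro w hw
        obtain ⟨c, hc, hpc, -⟩ := (hmem w).1 hw
        refine ⟨?_, subtree_trans hpc (mem_subtree_of_parent hc)⟩
        rintro rfl
        exact hR.parent_notMem hc hpc
    · refine ⟨bs, n + 1, M, MonotonePath.step hap' ?_ hp, hM, ?_, ?_, hpw⟩
      · intro hp2
        have h3 : 0 < cutNumber S T a :=
          (Set.ncard_pos (Set.toFinite _)).2 ⟨p, hT.parent_mem_boundary hap'⟩
        have h4 := h2 a
        have h5 : cutNumber S T a ≠ 1 := fun h => hcut ⟨hp2, h⟩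
        omega
      · rw [show n + 1 + M = n + M + 1 by omega]
        exact UpTo.step hap' hup
      · intro w
        rw [hmem']
        constructor
        · exact Or.inr
        · rintro (⟨-, h⟩ | h)
          · exact absurd h hcut
          · exact h

theorem search_spec [Fintype V] (hS : S.IsAcyclic) {D : Set V → ℕ} (hD : IsRank S D)
    (hT : IsSTT S T) (h2 : TwoCut S T)
    (hbranch : ∀ v, IsBranching S T x v ↔ ∃ c, T c = some v ∧ x ∈ subtree T c ∧
      cutNumber S T v = 2 ∧ cutNumber S T c = 1) {K : ℕ} (hK : ∀ A : Set V, x ∈ A → D A ≤ K) :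
    ∃ ops T', Search S x T ops T' ∧ IsSTT S T' ∧ TwoCut S T' ∧
      ops.length + 1 + 14 * potential D T ≤ 14 * potential D T' + 84 * K + 7 := by
  obtain ⟨r, hr, -⟩ := id hT.rooted
  obtain ⟨bs, n, M, hx, hM, hup, hmem, hpw⟩ := exists_branchChain hT h2 hr x
  obtain ⟨l₀, hdown₀, hlen₀⟩ := exists_goDown (S := S) hT.rooted hup
  obtain ⟨l₁, T₁, a, N₁, d, hph, hT₁, h2₁, hx₁, hd, hdn, hlen₁, hMN, hpot₁⟩ :=
    phaseOne_spec hS hD bs T x n 0 n M K hT h2 hx (UpTo.refl x) (Nat.zero_le _) hx hM (by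
      intro b hb
      rw [Option.mem_def.1 hb] at hx
      exact hK _ (hx.mem_subtree hT.rooted).1)
  obtain ⟨l₂, hdown₂, hlen₂⟩ := exists_goDown (S := S) hT₁.rooted hd
  obtain ⟨l₃, T₂, N₂, hsplay, hlen₃, hnN, hT₂, h2₂, -, -, -, -, hpot₂⟩ :=
    splay_spec hS hD _ T₁ hT₁ h2₁ hx₁
  refine ⟨l₀ ++ l₁ ++ l₂ ++ l₃, T₂, ⟨r, bs, _, _, _, _, l₀, l₁, l₂, l₃, hr, hdown₀, ⟨?_, hpw⟩, hph,
    hdown₂, hsplay, rfl, rfl⟩, hT₂, h2₂, ?_⟩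
  · intro v
    rw [hmem, hbranch]
  · have hxK := hK (subtree T₁ x) (mem_subtree_self T₁ x)
    simp only [List.length_append]
    omega

end

section

variable {S : SimpleGraph V}

/-! ### Directions -/

/-- `w` and `a` are connected in `S \ v`. -/
def Toward (S : SimpleGraph V) (v w a : V) : Prop :=
  ∃ C : Set V, (S.induce C).Connected ∧ v ∉ C ∧ w ∈ C ∧ a ∈ C

theorem Toward.unique (hS : S.IsAcyclic) {v w w' a : V} (hw : S.Adj v w) (hw' : S.Adj v w')
    (h : Toward S v w a) (h' : Toward S v w' a) : w = w' := by
  obtain ⟨C, hC, hv, hwC, haC⟩ := h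
  obtain ⟨C', hC', hv', hwC', haC'⟩ := h'
  exact adj_unique_of_connected hS (connected_union hC hC' haC haC') (not_or.2 ⟨hv, hv'⟩)
    (Or.inl hwC) (Or.inr hwC') hw hw'

theorem exists_toward (hS : S.Connected) {v a : V} (h : a ≠ v) :
    ∃ w, S.Adj v w ∧ Toward S v w a := by
  obtain ⟨p, hp⟩ := (hS v a).exists_isPath
  cases p with
  | nil => exact absurd rfl h
  | @cons _ w _ hvw q =>
    rw [SimpleGraph.Walk.cons_isPath_iff] at hp
    exact ⟨w, hvw, {z | z ∈ q.support}, q.connected_induce_support, hp.2, q.start_mem_support,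
      q.end_mem_support⟩

theorem mem_takeUntil_dropUntil [DecidableEq V] {a b v w : V} {p : S.Walk a b} (hp : p.IsPath)
    (hw : w ∈ p.support) (h₁ : v ∈ (p.takeUntil w hw).support)
    (h₂ : v ∈ (p.dropUntil w hw).support.tail) : False := by
  have h := hp.support_nodup
  rw [← p.take_spec hw, SimpleGraph.Walk.support_append] at h
  exact (List.disjoint_of_nodup_append h) h₁ h₂

theorem exists_toward_of_mem_hull {A : Set V} {v w : V} (hvw : S.Adj v w) (hw : w ∈ hull S A) :
    ∃ a ∈ A, Toward S v w a := by
  classical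
  obtain ⟨a, ha, b, hb, p, hp, hwp⟩ := hw
  by_cases h1 : v ∈ (p.takeUntil w hwp).support
  swap
  · exact ⟨a, ha, {z | z ∈ (p.takeUntil w hwp).support},
      (p.takeUntil w hwp).connected_induce_support, h1, SimpleGraph.Walk.end_mem_support _,
      SimpleGraph.Walk.start_mem_support _⟩
  by_cases h2 : v ∈ (p.dropUntil w hwp).support
  swap
  · exact ⟨b, hb, {z | z ∈ (p.dropUntil w hwp).support},
      (p.dropUntil w hwp).connected_induce_support, h2, SimpleGraph.Walk.start_mem_support _,
      SimpleGraph.Walk.end_mem_support _⟩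
  exfalso
  rw [← SimpleGraph.Walk.cons_tail_support, List.mem_cons] at h2
  exact mem_takeUntil_dropUntil hp hwp h1 (h2.resolve_left hvw.ne)

theorem mem_hull_of_toward {A : Set V} {v w a : V} (hv : v ∈ A) (ha : a ∈ A) (hvw : S.Adj v w)
    (h : Toward S v w a) : w ∈ hull S A := by
  obtain ⟨C, hC, hvC, hwC, haC⟩ := h
  obtain ⟨q, hq, hqC⟩ := exists_path_in hC hwC haC
  refine ⟨v, hv, a, ha, SimpleGraph.Walk.cons hvw q, ?_, ?_⟩
  · rw [SimpleGraph.Walk.cons_isPath_iff]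
    exact ⟨hq, fun h => hvC (hqC v h)⟩
  · rw [SimpleGraph.Walk.support_cons]
    exact List.mem_cons_of_mem _ q.start_mem_support

theorem exists_two_neighbours_on_path {a b v : V} {p : S.Walk a b} (hp : p.IsPath)
    (hv : v ∈ p.support) (hva : v ≠ a) (hvb : v ≠ b) :
    ∃ u ∈ p.support, ∃ w ∈ p.support, u ≠ w ∧ S.Adj v u ∧ S.Adj v w := by
  classical
  have h1 : ¬ (p.takeUntil v hv).Nil := fun h => hva h.eq.symm
  have h2 : ¬ (p.dropUntil v hv).Nil := fun h => hvb h.eq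
  have hw : (p.dropUntil v hv).snd ∈ (p.dropUntil v hv).support.tail :=
    SimpleGraph.Walk.snd_mem_tail_support h2
  have hu : (p.takeUntil v hv).penultimate ∈ (p.takeUntil v hv).support :=
    SimpleGraph.Walk.getVert_mem_support _ _
  refine ⟨_, p.support_takeUntil_subset_support hv hu, _,
    p.support_dropUntil_subset_support hv (List.mem_of_mem_tail hw), ?_,
    ((p.takeUntil v hv).adj_penultimate h1).symm, (p.dropUntil v hv).adj_snd h2⟩
  intro h
  rw [← h] at hw
  exact mem_takeUntil_dropUntil hp hv hu hw

theorem exists_path_through {B : Set V} (hB : (S.induce B).Connected) {a b k l : V}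
    (ha : a ∉ B) (hb : b ∉ B) (hab : a ≠ b) (hk : k ∈ B) (hl : l ∈ B) (hak : S.Adj a k)
    (hbl : S.Adj b l) : ∃ (p : S.Walk a b) (Q : Set V), p.IsPath ∧ Q ⊆ B ∧ k ∈ Q ∧
      l ∈ Q ∧ (S.induce Q).Connected ∧ ∀ z, z ∈ p.support ↔ z = a ∨ z ∈ Q ∨ z = b := by
  obtain ⟨q, hq, hqB⟩ := exists_path_in hB hk hl
  refine ⟨SimpleGraph.Walk.cons hak (q.concat hbl.symm), {z | z ∈ q.support}, ?_, hqB,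
    q.start_mem_support, q.end_mem_support, q.connected_induce_support, ?_⟩
  · rw [SimpleGraph.Walk.cons_isPath_iff, SimpleGraph.Walk.support_concat]
    refine ⟨hq.concat (fun h => hb (hqB _ h)) _, ?_⟩
    rw [List.mem_append, List.mem_singleton]
    rintro (h | h)
    · exact ha (hqB _ h)
    · exact hab h
  · intro z
    rw [SimpleGraph.Walk.support_cons, SimpleGraph.Walk.support_concat, List.mem_cons,
      List.mem_append, List.mem_singleton]
    rfl

/-! ### Steiner-closed trees are the 2-cut trees -/

section Steiner

variable {T : ParentMap V} {x v : V}

theorem exists_boundary_toward {w a : V} (ha : a ∉ subtree T v) (hvw : S.Adj v w)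
    (h : Toward S v w a) : ∃ e ∈ boundary S (subtree T v), Toward S v w e := by
  obtain ⟨C, hC, hvC, hwC, haC⟩ := h
  by_cases hw : w ∈ subtree T v
  · obtain ⟨u, -, e, he, hu, hen, hue⟩ := exists_adj_exit hC hwC hw haC ha
    exact ⟨e, ⟨hen, u, hu, hue⟩, C, hC, hvC, hwC, he⟩
  · exact ⟨w, ⟨hw, v, mem_subtree_self T v, hvw⟩, C, hC, hvC, hwC, hwC⟩

/-- A node lies in only one direction from `v`, so different neighbours `w` are assigned different
nodes of `B`. -/
theorem ncard_directions_le [Finite V] (hS : S.IsAcyclic) {B W : Set V}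
    (hW : ∀ w ∈ W, S.Adj v w ∧ ∃ e ∈ B, Toward S v w e) : W.ncard ≤ B.ncard := by
  have hex : ∀ w, ∃ e, w ∈ W → e ∈ B ∧ Toward S v w e := by
    intro w
    by_cases hw : w ∈ W
    · obtain ⟨-, e, he, h⟩ := hW w hw
      exact ⟨e, fun _ => ⟨he, h⟩⟩
    · exact ⟨w, fun h => absurd h hw⟩
  choose f hf using hex
  refine Set.ncard_le_ncard_of_injOn f (fun w hw => (hf w hw).1) ?_ (Set.toFinite _)
  intro w hw w' hw' heq
  have h := (hf w hw).2
  rw [heq] at h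
  exact Toward.unique hS (hW w hw).1 (hW w' hw').1 h (hf w' hw').2

/-- For `v` in the hull but off the path, every hull neighbour leads to a path node, which is
outside the subtree of `v`, and so to a node of its boundary: at most two directions. There are at
least two since `v` is interior to a path of the hull. -/
theorem TwoCut.steinerClosed [Finite V] (hS : S.IsAcyclic) (h2 : TwoCut S T) :
    SteinerClosed S T := by
  rintro x v ⟨hv, hvP⟩
  refine le_antisymm ?_ ?_
  · refine le_trans (ncard_directions_le hS (v := v) ?_) (h2 v)
    rintro w ⟨hvw, hw⟩
    obtain ⟨a, ha, haw⟩ := exists_toward_of_mem_hull hvw hw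
    refine ⟨hvw, exists_boundary_toward (fun h => hvP ?_) hvw haw⟩
    exact subtree_trans (T := T) ha h
  · obtain ⟨a, ha, b, hb, p, hp, hvp⟩ := hv
    obtain ⟨u, hu, w, hw, huw, hvu, hvw⟩ := exists_two_neighbours_on_path hp hvp
      (fun h => hvP (h ▸ ha)) (fun h => hvP (h ▸ hb))
    rw [hullDegree, ← Set.ncard_pair huw]
    refine Set.ncard_le_ncard ?_ (Set.toFinite _)
    rintro z (rfl | rfl)
    · exact ⟨hvu, a, ha, b, hb, p, hp, hu⟩
    · exact ⟨hvw, a, ha, b, hb, p, hp, hw⟩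

/-- Three outside neighbours of the subtree of `v` would all lie on the search path of its parent,
which avoids that subtree. The paths joining them through the subtree would fork there, at a node of
degree at least three in the hull. -/
theorem IsSTT.twoCut_of_steinerClosed [Finite V] (hT : IsSTT S T) (hSC : SteinerClosed S T) :
    TwoCut S T := by
  intro v
  by_contra hcut
  push Not at hcut
  rw [cutNumber, Set.two_lt_ncard_iff (Set.toFinite _)] at hcut
  obtain ⟨a, b, c, ha, hb, hc, hab, hac, hbc⟩ := hcut
  have hva := hT.mem_subtree_of_boundary ha
  rcases mem_subtree_iff.1 hva with rfl | ⟨p, hp, -⟩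
  · exact ha.1 (mem_subtree_self T v)
  have hmem : ∀ e ∈ boundary S (subtree T v), e ∈ searchPath T p := by
    intro e he
    refine (mem_subtree_iff_of_parent hp ?_).1 (hT.mem_subtree_of_boundary he)
    rintro rfl
    exact he.1 (mem_subtree_self T v)
  have hdis : ∀ z ∈ subtree T v, z ∉ searchPath T p := fun z hz h =>
    hT.rooted.parent_notMem hp (subtree_trans h hz)
  obtain ⟨ha', k, hk, hka⟩ := id ha
  obtain ⟨hb', l, hl, hlb⟩ := id hb
  obtain ⟨hc', m, hm, hmc⟩ := id hc
  obtain ⟨P, Q, hP, hQ, hkQ, hlQ, -, hPQ⟩ :=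
    exists_path_through (hT.conn v) ha' hb' hab hk hl hka.symm hlb.symm
  obtain ⟨P', Q', hP', hQ', hkQ', hmQ', hconn, hPQ'⟩ :=
    exists_path_through (hT.conn v) ha' hc' hac hk hm hka.symm hmc.symm
  have hhull : ∀ z ∈ P.support, z ∈ hull S (searchPath T p) := fun z hz =>
    ⟨a, hmem a ha, b, hmem b hb, P, hP, hz⟩
  have hhull' : ∀ z ∈ P'.support, z ∈ hull S (searchPath T p) := fun z hz =>
    ⟨a, hmem a ha, c, hmem c hc, P', hP', hz⟩
  -- The two neighbours of `z` on `P` exhaust its hull degree, so the path to `c` can never leave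
  -- `P` inside the subtree.
  have hclosed : ∀ z ∈ Q, ∀ e ∈ hull S (searchPath T p), S.Adj z e → e ∈ P.support := by
    intro z hz e he hze
    have hzP : z ∈ P.support := (hPQ z).2 (Or.inr (Or.inl hz))
    obtain ⟨u, hu, w, hw, huw, hzu, hzw⟩ := exists_two_neighbours_on_path hP hzP
      (fun h => ha' (h ▸ hQ hz)) (fun h => hb' (h ▸ hQ hz))
    have hdeg := hSC p z ⟨hhull z hzP, hdis z (hQ hz)⟩
    by_contra heP
    have hsub : ({e, u, w} : Set V) ⊆ S.neighborSet z ∩ hull S (searchPath T p) := by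
      rintro y (rfl | rfl | rfl)
      · exact ⟨hze, he⟩
      · exact ⟨hzu, hhull _ hu⟩
      · exact ⟨hzw, hhull _ hw⟩
    have h3 : ({e, u, w} : Set V).ncard = 3 := Set.ncard_eq_three.2
      ⟨e, u, w, fun h => heP (h ▸ hu), fun h => heP (h ▸ hw), huw, rfl⟩
    have h4 := Set.ncard_le_ncard hsub (Set.toFinite _)
    rw [hullDegree] at hdeg
    omega
  have hcP : c ∉ P.support := by
    rw [hPQ]
    rintro (h | h | h)
    · exact hac h.symm
    · exact hc' (hQ h)
    · exact hbc h.symm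
  obtain ⟨u, hu, e, he, huP, heP, hue⟩ := exists_adj_exit (A := {z | z ∈ P.support})
    (connected_insert hconn hmQ' hmc.symm) (Set.mem_insert_of_mem c hkQ')
    ((hPQ k).2 (Or.inr (Or.inl hkQ))) (Set.mem_insert c Q') hcP
  have huQ : u ∈ Q := by
    have huB : u ∈ subtree T v := by
      rcases hu with rfl | hu
      · exact absurd huP hcP
      · exact hQ' hu
    rcases (hPQ u).1 huP with rfl | h | rfl
    · exact absurd huB ha'
    · exact h
    · exact absurd huB hb'
  refine heP (hclosed u huQ e (hhull' e ((hPQ' e).2 ?_)) hue)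
  rcases he with rfl | he
  · exact Or.inr (Or.inr rfl)
  · exact Or.inr (Or.inl he)

/-! ### Branching nodes by cut numbers -/

theorem IsSTT.boundary_direction (hS : S.IsAcyclic) (hT : IsSTT S T) {w e : V}
    (he : e ∈ boundary S (subtree T v)) (hvw : S.Adj v w) (h : Toward S v w e) :
    w = e ∨ ∃ c, T c = some v ∧ w ∈ subtree T c ∧ e ∈ boundary S (subtree T c) := by
  obtain ⟨hev, k, hk, hke⟩ := he
  obtain ⟨C, hC, hvC, hwC, heC⟩ := h
  by_cases hkv : k = v
  · subst hkv
    exact Or.inl (adj_unique_of_connected hS hC hvC hwC heC hvw hke)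
  obtain ⟨c, hc, hkc⟩ := exists_child_of_mem_subtree hk hkv
  obtain ⟨i, hi, hvi⟩ := hT.exists_adj_parent hc
  have := adj_unique_of_connected hS (connected_union_of_adj hC (hT.conn c) heC hkc hke.symm)
    (v := v) (not_or.2 ⟨hvC, hT.rooted.parent_notMem hc⟩) (Or.inl hwC) (Or.inr hi) hvw hvi
  subst this
  exact Or.inr ⟨c, hc, hi, fun h => hev (subtree_trans h (mem_subtree_of_parent hc)), k, hkc, hke⟩

/-- Two boundary nodes in the same direction would border one common child subtree, which borders
`v` as well. -/
theorem IsSTT.directions_injective [Finite V] (hS : S.IsAcyclic) (hT : IsSTT S T)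
    (h2 : TwoCut S T) {w e e' : V} (he : e ∈ boundary S (subtree T v))
    (he' : e' ∈ boundary S (subtree T v)) (hvw : S.Adj v w) (h : Toward S v w e)
    (h' : Toward S v w e') : e = e' := by
  have hnot : ∀ {c f}, T c = some v → f ∈ subtree T c → f ∉ boundary S (subtree T v) :=
    fun hc hf hb => hb.1 (subtree_trans hf (mem_subtree_of_parent hc))
  rcases hT.boundary_direction hS he hvw h with rfl | ⟨c, hc, hwc, hec⟩
  · rcases hT.boundary_direction hS he' hvw h' with h | ⟨c', hc', hwc', -⟩
    · exact h
    · exact absurd he (hnot hc' hwc')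
  · rcases hT.boundary_direction hS he' hvw h' with rfl | ⟨c', hc', hwc', hec'⟩
    · exact absurd he' (hnot hc hwc)
    · have hcc := hT.rooted.child_unique hc hc' hwc hwc'
      subst hcc
      by_contra hne
      refine h2.false_of_three (hT.parent_mem_boundary hc) hec hec' ?_ ?_ hne
      · rintro rfl
        exact he.1 (mem_subtree_self T v)
      · rintro rfl
        exact he'.1 (mem_subtree_self T v)

/-- All path nodes below `v` lie in one direction, that of the child subtree containing `x`; the
others lead to the boundary of the subtree of `v`, at most two directions. Degree above two thus
needs two boundary nodes, neither in the direction of that child, and the latter means that the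
child subtree borders only `v`. -/
theorem IsSTT.isBranching_iff [Finite V] (hS : S.IsTree) (hT : IsSTT S T) (h2 : TwoCut S T) :
    IsBranching S T x v ↔ ∃ c, T c = some v ∧ x ∈ subtree T c ∧
      cutNumber S T v = 2 ∧ cutNumber S T c = 1 := by
  have hR := hT.rooted
  have hA := hS.isAcyclic
  constructor
  · rintro ⟨hv, hdeg⟩
    rw [hullDegree] at hdeg
    set W := S.neighborSet v ∩ hull S (searchPath T x) with hWdef
    have hW : ∀ w ∈ W, S.Adj v w ∧ ((∃ e ∈ boundary S (subtree T v), Toward S v w e) ∨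
        ∃ a ∈ subtree T v, a ≠ v ∧ x ∈ subtree T a ∧ Toward S v w a) := by
      rintro w ⟨hvw, hw⟩
      refine ⟨hvw, ?_⟩
      obtain ⟨a, ha, haw⟩ := exists_toward_of_mem_hull hvw hw
      by_cases hav : a ∈ subtree T v
      · refine Or.inr ⟨a, hav, ?_, ha, haw⟩
        rintro rfl
        obtain ⟨C, -, h1, -, h3⟩ := haw
        exact h1 h3
      · exact Or.inl (exists_boundary_toward hav hvw haw)
    have hxv : x ≠ v := by
      rintro rfl
      have := ncard_directions_le hA (v := x) (W := W) (B := boundary S (subtree T x)) (by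
        intro w hw
        obtain ⟨hvw, h | ⟨a, ha, hne, hxa, -⟩⟩ := hW w hw
        · exact ⟨hvw, h⟩
        · exact absurd (hR.antisymm ha hxa) hne)
      have h3 := h2 x
      rw [cutNumber] at h3
      omega
    obtain ⟨c, hc, hxc⟩ := exists_child_of_mem_subtree (T := T) hv hxv
    obtain ⟨k, hk, hvk⟩ := hT.exists_adj_parent hc
    have hvc : v ∉ subtree T c := hR.parent_notMem hc
    have hWk : ∀ w ∈ W, w ≠ k → S.Adj v w ∧ ∃ e ∈ boundary S (subtree T v), Toward S v w e := by
      intro w hw hwk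
      obtain ⟨hvw, h | ⟨a, ha, hne, hxa, haw⟩⟩ := hW w hw
      · exact ⟨hvw, h⟩
      · obtain ⟨c', hc', hac'⟩ := exists_child_of_mem_subtree ha hne
        rw [hR.child_unique hc' hc (subtree_trans hxa hac') hxc] at hac'
        exact absurd (Toward.unique hA hvw hvk haw ⟨_, hT.conn c, hvc, hk, hac'⟩) hwk
    have h3 := h2 v
    have hle := ncard_directions_le hA (v := v) (W := W \ {k}) (fun w hw => hWk w hw.1 hw.2)
    have h4 := Set.ncard_le_ncard_sdiff_add_ncard W {k} (Set.toFinite _)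
    rw [Set.ncard_singleton] at h4
    rw [cutNumber] at h3
    refine ⟨c, hc, hxc, by rw [cutNumber]; omega, ?_⟩
    rw [cutNumber, Set.ncard_eq_one]
    refine ⟨v, Set.eq_singleton_iff_unique_mem.2 ⟨hT.parent_mem_boundary hc, ?_⟩⟩
    intro e he
    by_contra hev
    have heb := (hT.boundary_subset hc he).resolve_left hev
    have htow : Toward S v k e := by
      obtain ⟨-, j, hj, hje⟩ := he
      refine ⟨_, connected_insert (hT.conn c) hj hje.symm, ?_, Set.mem_insert_of_mem _ hk,
        Set.mem_insert _ _⟩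
      rintro (h | h)
      · exact hev h.symm
      · exact hvc h
    have := ncard_directions_le hA (v := v) (W := W) (B := boundary S (subtree T v)) (by
      intro w hw
      by_cases hwk : w = k
      · subst hwk
        exact ⟨hvk, e, heb, htow⟩
      · exact hWk w hw hwk)
    omega
  · rintro ⟨c, hc, hxc, hv2, hc1⟩
    have hxv : x ∈ subtree T v := subtree_trans hxc (mem_subtree_of_parent hc)
    have hvc : v ∉ subtree T c := hR.parent_notMem hc
    refine ⟨hxv, ?_⟩
    rw [cutNumber, Set.ncard_eq_two] at hv2
    obtain ⟨e, f, hef, hbd⟩ := hv2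
    have he : e ∈ boundary S (subtree T v) := by simp [hbd]
    have hf : f ∈ boundary S (subtree T v) := by simp [hbd]
    obtain ⟨k, hk, hvk⟩ := hT.exists_adj_parent hc
    have hdir : ∀ e ∈ boundary S (subtree T v), ∃ w, S.Adj v w ∧ Toward S v w e ∧ w ≠ k ∧
        w ∈ hull S (searchPath T x) := by
      intro e he
      have hev : e ≠ v := by
        rintro rfl
        exact he.1 (mem_subtree_self T e)
      obtain ⟨w, hvw, hwe⟩ := exists_toward hS.connected hev
      refine ⟨w, hvw, hwe, ?_, mem_hull_of_toward hxv
        (subtree_trans hxv (hT.mem_subtree_of_boundary he)) hvw hwe⟩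
      -- A connected set reaching `e` from the subtree of `c` has to leave through its only outside
      -- neighbour `v`.
      rintro rfl
      obtain ⟨C, hC, hvC, hwC, heC⟩ := hwe
      obtain ⟨u, -, g, hg, hu, hgc, hug⟩ := exists_adj_exit hC hwC hk heC
        (fun h => he.1 (subtree_trans h (mem_subtree_of_parent hc)))
      rw [cutNumber, Set.ncard_eq_one] at hc1
      obtain ⟨y, hy⟩ := hc1
      have h1 : g ∈ boundary S (subtree T c) := ⟨hgc, u, hu, hug⟩
      have h2 := hT.parent_mem_boundary hc
      rw [hy] at h1 h2
      exact hvC (h2.trans h1.symm ▸ hg)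
    obtain ⟨w, hvw, hwe, hwk, hwh⟩ := hdir e he
    obtain ⟨w', hvw', hwf, hwk', hwh'⟩ := hdir f hf
    have hww : w ≠ w' := by
      rintro rfl
      exact hef (hT.directions_injective hA h2 he hf hvw hwe hwf)
    have hkh : k ∈ hull S (searchPath T x) :=
      mem_hull_of_toward hxv (searchPath_refl T x) hvk ⟨_, hT.conn c, hvc, hk, hxc⟩
    rw [hullDegree, Set.two_lt_ncard_iff (Set.toFinite _)]
    exact ⟨k, w, w', ⟨hvk, hkh⟩, ⟨hvw, hwh⟩, ⟨hvw', hwh'⟩, hwk.symm, hwk'.symm, hww⟩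

end Steiner

end

section

variable {S : SimpleGraph V}

/-! ### Determinism of the procedures -/

theorem Step.unique {s s₁ s₂ : State V} {o : Op V} (h₁ : Step S s o s₁) (h₂ : Step S s o s₂) :
    s₁ = s₂ := by
  cases h₁ with
  | up T x p h =>
    cases h₂ with
    | up _ _ p' h' =>
      rw [h] at h'
      cases h'
      rfl
  | down T x c h =>
    cases h₂
    rfl
  | rot T x p h =>
    cases h₂
    rfl

theorem Run.unique {s s₁ s₂ : State V} {l : List (Op V)} (h₁ : Run S s l s₁) (h₂ : Run S s l s₂) :
    s₁ = s₂ := by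
  induction h₁ with
  | nil =>
    cases h₂
    rfl
  | cons h _ ih =>
    cases h₂ with
    | cons h' h₂ =>
      cases h.unique h'
      exact ih h₂

theorem GoUp.unique {a : V} {s s₁ s₂ : State V} {l₁ l₂ : List (Op V)} (h₁ : GoUp S a s l₁ s₁)
    (h₂ : GoUp S a s l₂ s₂) : l₁ = l₂ ∧ s₁ = s₂ := by
  induction h₁ generalizing l₂ with
  | arrived s h =>
    cases h₂ with
    | arrived => exact ⟨rfl, rfl⟩
    | move h' => exact absurd h h'
  | move h hs _ ih =>
    cases h₂ with
    | arrived _ h' => exact absurd h' h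
    | move h' hs' h₂ =>
      cases hs.unique hs'
      obtain ⟨rfl, rfl⟩ := ih h₂
      exact ⟨rfl, rfl⟩

theorem GoDown.unique {x : V} {s s₁ s₂ : State V} {l₁ l₂ : List (Op V)} (hR : Rooted s.tree)
    (h₁ : GoDown S x s l₁ s₁) (h₂ : GoDown S x s l₂ s₂) : l₁ = l₂ ∧ s₁ = s₂ := by
  induction h₁ generalizing l₂ with
  | arrived s h =>
    cases h₂ with
    | arrived => exact ⟨rfl, rfl⟩
    | move h' => exact absurd h h'
  | move h hc hs _ ih =>
    cases h₂ with
    | arrived _ h' => exact absurd h' h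
    | move h' hc' hs' h₂ =>
      cases hs with
      | down T a c hca =>
        cases hs' with
        | down _ _ c' hca' =>
          cases hR.child_unique hca hca' hc hc'
          obtain ⟨rfl, rfl⟩ := ih hR h₂
          exact ⟨rfl, rfl⟩

theorem Splay.unique {x : V} {y : Option V} {s s₁ s₂ : State V} {l₁ l₂ : List (Op V)}
    (h₁ : Splay S x y s l₁ s₁) (h₂ : Splay S x y s l₂ s₂) : l₁ = l₂ ∧ s₁ = s₂ := by
  induction h₁ generalizing l₂ with
  | done s _ hx =>
    cases h₂ with
    | done => exact ⟨rfl, rfl⟩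
    | zig _ hx' hne => exact absurd (hx'.symm.trans hx) hne
    | zigzig _ hx' hne => exact absurd (hx'.symm.trans hx) hne
    | zigzag _ hx' hne => exact absurd (hx'.symm.trans hx) hne
  | zig _ hx hne hp hrun _ ih =>
    cases h₂ with
    | done _ _ hx' => exact absurd (hx.symm.trans hx') hne
    | zig _ hx' _ _ hrun' h₂ =>
      cases hrun.unique hrun'
      obtain ⟨rfl, rfl⟩ := ih h₂
      exact ⟨rfl, rfl⟩
    | zigzig _ hx' _ hp' hgy =>
      cases hx.symm.trans hx'
      exact absurd (hp'.symm.trans hp) hgy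
    | zigzag _ hx' _ hp' hgy =>
      cases hx.symm.trans hx'
      exact absurd (hp'.symm.trans hp) hgy
  | zigzig _ hx hne hp hgy hsep hrun _ ih =>
    cases h₂ with
    | done _ _ hx' => exact absurd (hx.symm.trans hx') hne
    | zig _ hx' _ hp' =>
      cases hx.symm.trans hx'
      exact absurd (hp.symm.trans hp') hgy
    | zigzig _ hx' _ hp' _ _ hrun' h₂ =>
      cases hx.symm.trans hx'
      cases hrun.unique hrun'
      obtain ⟨rfl, rfl⟩ := ih h₂
      exact ⟨rfl, rfl⟩
    | zigzag _ hx' _ hp' _ hsep' =>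
      cases hx.symm.trans hx'
      cases hp.symm.trans hp'
      exact absurd hsep hsep'
  | zigzag _ hx hne hp hgy hnsep hsep hrun _ ih =>
    cases h₂ with
    | done _ _ hx' => exact absurd (hx.symm.trans hx') hne
    | zig _ hx' _ hp' =>
      cases hx.symm.trans hx'
      exact absurd (hp.symm.trans hp') hgy
    | zigzig _ hx' _ hp' _ hsep' =>
      cases hx.symm.trans hx'
      cases hp.symm.trans hp'
      exact absurd hsep' hnsep
    | zigzag _ hx' _ hp' _ _ _ hrun' h₂ =>
      cases hrun.unique hrun'
      obtain ⟨rfl, rfl⟩ := ih h₂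
      exact ⟨rfl, rfl⟩

theorem PhaseOne.unique {bs : List V} {s s₁ s₂ : State V} {l₁ l₂ : List (Op V)}
    (h₁ : PhaseOne S bs s l₁ s₁) (h₂ : PhaseOne S bs s l₂ s₂) : l₁ = l₂ ∧ s₁ = s₂ := by
  induction h₁ generalizing l₂ with
  | nil =>
    cases h₂
    exact ⟨rfl, rfl⟩
  | cons hup hsp _ ih =>
    cases h₂ with
    | cons hup' hsp' h₂ =>
      obtain ⟨rfl, rfl⟩ := hup.unique hup'
      obtain ⟨rfl, rfl⟩ := hsp.unique hsp'
      obtain ⟨rfl, rfl⟩ := ih h₂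
      exact ⟨rfl, rfl⟩

/-- The lists have the same members without repetition, and the ancestor order is antisymmetric. -/
theorem IsBranchingList.unique {T : ParentMap V} (hR : Rooted T) {x : V} {bs bs' : List V}
    (h : IsBranchingList S T x bs) (h' : IsBranchingList S T x bs') : bs = bs' := by
  have hnd : ∀ {l : List V}, IsBranchingList S T x l → l.Nodup := fun h =>
    h.2.imp fun h => h.1.symm
  have hperm : bs.Perm bs' := (List.perm_ext_iff_of_nodup (hnd h) (hnd h')).2 fun v => by
    rw [h.1, h'.1]
  refine hperm.eq_of_pairwise ?_ h.2 h'.2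
  intro a b _ _ hab hba
  exact absurd (hR.antisymm hab.2 hba.2).symm hab.1

/-! ### Executions keep the tree rooted. -/

theorem Step.rooted [Finite V] {s s' : State V} {o : Op V} (h : Step S s o s')
    (hR : Rooted s.tree) : Rooted s'.tree := by
  cases h with
  | up => exact hR
  | down => exact hR
  | rot T x p h => exact Rooted.rotate hR h

theorem Run.rooted [Finite V] {s s' : State V} {l : List (Op V)} (h : Run S s l s')
    (hR : Rooted s.tree) : Rooted s'.tree := by
  induction h with
  | nil => exact hR
  | cons h _ ih => exact ih (h.rooted hR)

theorem GoUp.rooted [Finite V] {a : V} {s s' : State V} {l : List (Op V)} (h : GoUp S a s l s')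
    (hR : Rooted s.tree) : Rooted s'.tree := by
  induction h with
  | arrived => exact hR
  | move _ h _ ih => exact ih (h.rooted hR)

theorem GoDown.rooted [Finite V] {a : V} {s s' : State V} {l : List (Op V)}
    (h : GoDown S a s l s') (hR : Rooted s.tree) : Rooted s'.tree := by
  induction h with
  | arrived => exact hR
  | move _ _ h _ ih => exact ih (h.rooted hR)

theorem Splay.rooted [Finite V] {x : V} {y : Option V} {s s' : State V} {l : List (Op V)}
    (h : Splay S x y s l s') (hR : Rooted s.tree) : Rooted s'.tree := by
  induction h with
  | done => exact hR
  | zig _ _ _ _ h _ ih => exact ih (h.rooted hR)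
  | zigzig _ _ _ _ _ _ h _ ih => exact ih (h.rooted hR)
  | zigzag _ _ _ _ _ _ _ h _ ih => exact ih (h.rooted hR)

theorem PhaseOne.rooted [Finite V] {bs : List V} {s s' : State V} {l : List (Op V)}
    (h : PhaseOne S bs s l s') (hR : Rooted s.tree) : Rooted s'.tree := by
  induction h with
  | nil => exact hR
  | cons h₁ h₂ _ ih => exact ih (h₂.rooted (h₁.rooted hR))

theorem Search.unique [Finite V] {T T₁ T₂ : ParentMap V} (hR : Rooted T) {x : V}
    {l₁ l₂ : List (Op V)} (h₁ : Search S x T l₁ T₁) (h₂ : Search S x T l₂ T₂) :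
    l₁ = l₂ ∧ T₁ = T₂ := by
  obtain ⟨r, bs, s₀, s₁, s₂, s₃, k₀, k₁, k₂, k₃, hr, h0, hb, h1, h2, h3, rfl, rfl⟩ := h₁
  obtain ⟨r', bs', s₀', s₁', s₂', s₃', k₀', k₁', k₂', k₃', hr', h0', hb', h1', h2', h3', rfl,
    rfl⟩ := h₂
  obtain rfl := hR.root_unique hr hr'
  obtain ⟨rfl, rfl⟩ := h0.unique hR h0'
  obtain rfl := hb.unique hR hb'
  obtain ⟨rfl, rfl⟩ := h1.unique h1'
  obtain ⟨rfl, rfl⟩ := h2.unique (h1.rooted (h0.rooted hR)) h2'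
  obtain ⟨rfl, rfl⟩ := h3.unique h3'
  exact ⟨rfl, rfl⟩

/-! ### The rank given by a static tree -/

section StaticRank

variable {R : ParentMap V}

theorem one_le_depth [Finite V] (R : ParentMap V) (x : V) : 1 ≤ depth R x :=
  (Set.ncard_pos (Set.toFinite _)).2 ⟨x, searchPath_refl R x⟩

theorem depth_le_card [Fintype V] (R : ParentMap V) (x : V) : depth R x ≤ Fintype.card V := by
  rw [← Nat.card_eq_fintype_card]
  exact Set.ncard_le_card _

theorem depth_lt_depth [Finite V] (hR : Rooted R) {x y : V} (h : y ∈ subtree R x) (hne : y ≠ x) :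
    depth R x < depth R y := by
  refine Set.ncard_lt_ncard ⟨fun a ha => subtree_trans (T := R) h ha, fun hsub => ?_⟩
    (Set.toFinite _)
  exact hne (hR.antisymm h (hsub (searchPath_refl R y)))

/-- The smallest depth in `R` of a node of `A`. -/
noncomputable def minDepth (R : ParentMap V) (A : Set V) : ℕ := sInf (depth R '' A)

theorem minDepth_le {A : Set V} {x : V} (hx : x ∈ A) : minDepth R A ≤ depth R x :=
  Nat.sInf_le ⟨x, hx, rfl⟩

theorem exists_depth_eq_minDepth {A : Set V} (hA : A.Nonempty) :
    ∃ a ∈ A, depth R a = minDepth R A :=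
  Nat.sInf_mem (hA.image _)

/-- Take a node of least depth in `C`: an edge of `C` leaving its subtree would end in one of its
proper ancestors, which has smaller depth. -/
theorem IsSTT.exists_top_of_connected [Finite V] (hR : IsSTT S R) {C : Set V}
    (hC : (S.induce C).Connected) : ∃ m ∈ C, C ⊆ subtree R m := by
  obtain ⟨⟨c, hc⟩⟩ := hC.nonempty
  obtain ⟨m, hm, hmin⟩ := exists_depth_eq_minDepth (R := R) ⟨c, hc⟩
  refine ⟨m, hm, fun z hz => ?_⟩
  by_contra hzm
  obtain ⟨u, -, e, he, hu, hem, hue⟩ := exists_adj_exit hC hm (mem_subtree_self R m) hz hzm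
  have hme := hR.mem_subtree_of_boundary ⟨hem, u, hu, hue⟩
  have hlt := depth_lt_depth hR.rooted hme (fun h => hem (h ▸ mem_subtree_self R m))
  have := minDepth_le (R := R) he
  omega

/-- At most one of two disjoint parts contains the top node of `C`; in the other part every depth is
strictly larger. Nonemptiness matters because `minDepth` of the empty set is 0. -/
theorem IsSTT.isRank_minDepth [Finite V] (hR : IsSTT S R) : IsRank S (minDepth R) where
  mono A B hAB hA := by
    obtain ⟨a, ha, h⟩ := exists_depth_eq_minDepth (R := R) hA
    rw [← h]
    exact minDepth_le (hAB ha)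
  disjoint A B C hA hB hAC hBC hdis hC := by
    obtain ⟨m, hm, hCm⟩ := hR.exists_top_of_connected hC
    obtain ⟨a, ha, h⟩ := exists_depth_eq_minDepth (R := R) hA
    obtain ⟨b, hb, h'⟩ := exists_depth_eq_minDepth (R := R) hB
    have h1 := minDepth_le (R := R) (hAC ha)
    have h2 := minDepth_le (R := R) (hBC hb)
    have h3 := minDepth_le (R := R) hm
    by_cases ham : a = m
    · have hbm : b ≠ m := fun hbm => Set.disjoint_left.1 hdis ha ((ham.trans hbm.symm) ▸ hb)
      have := depth_lt_depth hR.rooted (hCm (hBC hb)) hbm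
      omega
    · have := depth_lt_depth hR.rooted (hCm (hAC ha)) ham
      omega

theorem potential_minDepth_le [Fintype V] (R T : ParentMap V) :
    potential (minDepth R) T ≤ Fintype.card V ^ 2 := by
  rw [sq]
  refine le_trans (Finset.sum_le_card_nsmul _ _ (Fintype.card V) fun v _ => ?_) (by simp)
  exact (minDepth_le (mem_subtree_self T v)).trans (depth_le_card R v)

end StaticRank

/-! ### Serving a sequence -/

/-- Existence comes from the constructed searches; for an arbitrary execution, determinism
identifies each search with the constructed one, so the amortised costs add up. -/
theorem serve_spec [Fintype V] (hS : S.IsTree) {R : ParentMap V} (hR : IsSTT S R) (X : List V) :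
    ∀ T : ParentMap V, IsSTT S T → TwoCut S T → (∃ c T', Serve S T X c T') ∧
      ∀ c T', Serve S T X c T' → IsSTT S T' ∧ TwoCut S T' ∧
        c + 14 * potential (minDepth R) T ≤
          14 * potential (minDepth R) T' + 91 * staticCost R X := by
  induction X with
  | nil =>
    intro T hT h2
    refine ⟨⟨0, T, Serve.nil T⟩, ?_⟩
    rintro c T' h
    cases h
    exact ⟨hT, h2, by simp⟩
  | cons x X ih =>
    intro T hT h2
    obtain ⟨ops, T₁, hsearch, hT₁, h2₁, hcost⟩ := search_spec (x := x) hS.isAcyclic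
      hR.isRank_minDepth hT h2 (fun v => hT.isBranching_iff hS h2) (K := depth R x)
      (fun A hA => minDepth_le hA)
    obtain ⟨⟨c, T', hserve⟩, hall⟩ := ih T₁ hT₁ h2₁
    refine ⟨⟨_, T', Serve.cons hsearch hserve⟩, ?_⟩
    intro c' T'' h
    cases h with
    | cons hsearch' hserve' =>
      obtain ⟨rfl, rfl⟩ := hsearch.unique hT.rooted hsearch'
      obtain ⟨h3, h4, h5⟩ := hall _ _ hserve'
      refine ⟨h3, h4, ?_⟩
      -- Depths are at least 1, so the additive 7 per search is absorbed: `84 + 7 = 91`.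
      have h6 := one_le_depth R x
      have h7 : staticCost R (x :: X) = depth R x + staticCost R X := by simp [staticCost]
      omega

end

end STT

/-! ### The main theorem. -/

theorem theorem3 :
    ∃ C : ℕ, ∀ (V : Type*) [Fintype V] (S : SimpleGraph V), S.IsTree →
      ∀ T₀ : STT.ParentMap V, STT.IsSearchTree S T₀ → STT.SteinerClosed S T₀ →
      ∀ X : List V,
        (∃ (c : ℕ) (T' : STT.ParentMap V), STT.Serve S T₀ X c T') ∧
        ∀ (c : ℕ) (T' : STT.ParentMap V), STT.Serve S T₀ X c T' →
          STT.IsSearchTree S T' ∧ STT.SteinerClosed S T' ∧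
          c ≤ C * (STT.opt S X + Fintype.card V ^ 2) := by
  -- The factor of the depth bound; the potential enters only with factor 14. The minimum in `opt`
  -- is attained because `T₀` itself is a competitor.
  refine ⟨91, fun V _ S hS T₀ hT₀ hSC X => ?_⟩
  obtain ⟨R, hR, hopt⟩ : STT.opt S X ∈
      {c | ∃ R : STT.ParentMap V, STT.IsSearchTree S R ∧ c = STT.staticCost R X} :=
    Nat.sInf_mem ⟨_, T₀, hT₀, rfl⟩
  have hT := hT₀.isSTT hS.connected
  obtain ⟨hex, hall⟩ := STT.serve_spec hS (hR.isSTT hS.connected) X T₀ hT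
    (hT.twoCut_of_steinerClosed hSC)
  refine ⟨hex, fun c T' h => ?_⟩
  obtain ⟨h1, h2, h3⟩ := hall c T' h
  refine ⟨h1.isSearchTree, h2.steinerClosed hS.isAcyclic, ?_⟩
  have h4 := STT.potential_minDepth_le R T'
  rw [hopt]
  omega
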